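/- Let $M$ be a nonempty smooth (Hausdorff) oriented Riemannian manifold of dimension $n\ge 3$ with a spin structure, and let $S$ be its complex spinor bundle, associated with the spinor representation $\mathbf S$ of $\mathrm{Spin}(n)$ of dimension $2^{[n/2]}$. For $0\le j\le k\le [n/2]$ let $E^{k,j}\subset\Lambda^k(\mathbb C^n)\otimes\mathbf S$ be the sum of the irreducible $\mathrm{Spin}(n)$-subrepresentations with highest weight $\lambda_j=(\tfrac32,\dots,\tfrac32,\tfrac12,\dots,\tfrac12)$ ($[n/2]$ entries, $j$ of them equal to $\tfrac32$) or, if $n$ is even, with highest weight $\lambda_j$ or the weight obtained from $\lambda_j$ by changing the sign of its last entry. Denote by $E^{k,j}$ also the associated bundle of spinor-valued $k$-forms, and let $\pi_{k,j}$ be the projection of $\Lambda^k(\mathbb C^n)\otimes\mathbf S$ onto $E^{k,j}$ along the sum of all other irreducible subrepresentations. Let $\nabla^S$ be the covariant exterior derivative on spinor-valued forms given by the Levi-Civita connection, and for $0\le j\le \tfrac n2-1$ put $$T_j=\pi_{j+1,j+1}\circ\nabla^S|_{\Gamma(E^{j,j})}.$$ Then: 1. The principal symbol of $T_j$ is $\sigma(\xi)\eta=\pi_{j+1,j+1}(\xi\wedge\eta)$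 for a complex covector $\xi$ and $\eta\in E^{j,j}$, that is, $T_j(fs)-f\,T_j(s)=\sigma(df)s$ for all smooth functions $f:M\to\mathbb C$ and all smooth sections $s$ of $E^{j,j}$. It is nontrivial: for every $x\in M$ there are a real covector $\xi\in T_x^*M$ and an element $\eta$ of the fibre of $E^{j,j}$ at $x$ with $\sigma(\xi)\eta\neq0$. 2. Let $v_m=\epsilon_{2m-1}-i\,\epsilon_{2m}$ $(1\le m\le[n/2])$, where $\epsilon_1,\dots,\epsilon_n$ is the standard basis of covectors on $\mathbb R^n$; this is a weight vector of $\mathbb C^n$ whose weight has $1$ in the $m$-th place and $0$ elsewhere. Let $s_0\in\mathbf S$ be a weight vector of the highest weight $(\tfrac12,\dots,\tfrac12)$. Then $v_1\wedge\dots\wedge v_j\otimes s_0$ lies in $E^{j,j}$ and is a weight vector for its (lexicographically) highest weight $\lambda_j$, and $$\sigma(v_{j+1})(v_1\wedge\dots\wedge v_j\otimes s_0)=(-1)^j\,v_1\wedge\dots\wedge v_{j+1}\otimes s_0\neq 0 .$$ 3. The kernel of $T_j$ is a proper subspace of the space $\Gamma(E^{j,j})$ of smooth sections of $E^{j,j}$.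 -/

import Mathlib

open Bundle
open scoped Manifold ContDiff

noncomputable section

namespace SpinForms

/-! ## The Clifford algebra, the group `Spin(n)` and the spinor representation -/

/-- Euclidean space `ℝⁿ`. -/
abbrev E (n : ℕ) := EuclideanSpace ℝ (Fin n)

/-- The standard orthonormal basis vectors of `ℝⁿ`. -/
def e {n : ℕ} (i : Fin n) : E n := EuclideanSpace.single i 1

/-- The quadratic form `v ↦ -|v|²`, so that `v · v = -|v|²` in the Clifford algebra. -/
def Q (n : ℕ) : QuadraticForm ℝ (E n) := -(LinearMap.BilinMap.toQuadraticMap (innerₗ (E n)))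

theorem Q_apply {n : ℕ} (v : E n) : Q n v = -inner ℝ v v := rfl

/-- The compact group `Spin(n)`. -/
abbrev Spin (n : ℕ) := spinGroup (Q n)

/-- The complex spinor space `S`, of dimension `2 ^ ⌊n/2⌋`, in its Fock space model: the standard
basis is indexed by the occupation patterns `Fin ⌊n/2⌋ → Bool`. -/
abbrev S (n : ℕ) := EuclideanSpace ℂ (Fin (n / 2) → Bool)

/-- The Jordan-Wigner sign `∏_{l < m} (-1) ^ (b l)`. -/
def jwSign {k : ℕ} (m : ℕ) (b : Fin k → Bool) : ℂ :=
  ∏ l : Fin k, if l.val < m ∧ b l = true then -1 else 1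

/-- The pattern `b` with the `m`-th entry flipped. -/
def flipAt {k : ℕ} (m : Fin k) (b : Fin k → Bool) : Fin k → Bool := Function.update b m (!b m)

/-- The coefficient of the `i`-th generator of the Clifford algebra when it flips the entry `m`. -/
def genCoeff {k : ℕ} (i : ℕ) (m : Fin k) (b : Fin k → Bool) : ℂ :=
  (if i % 2 = 0 then Complex.I else if b m = true then 1 else -1) * jwSign m b

/-- Clifford multiplication by the basis vector `e i` (Jordan-Wigner form).
The vectors with indices `2m` and `2m+1` flip the entry `m`; if `n` is odd, the
last vector acts diagonally. -/
def gen (n : ℕ) (i : Fin n) : S n →L[ℂ] S n :=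
  LinearMap.toContinuousLinearMap
    { toFun := fun s => WithLp.toLp 2 fun b =>
        if h : i.val / 2 < n / 2 then
          genCoeff i.val ⟨i.val / 2, h⟩ b * s (flipAt ⟨i.val / 2, h⟩ b)
        else Complex.I * jwSign (n / 2) b * s b
      map_add' := by
        intro s t; ext b; by_cases h : i.val / 2 < n / 2 <;> simp [h, mul_add]
      map_smul' := by
        intro c s; ext b; by_cases h : i.val / 2 < n / 2 <;> simp [h] <;> ring }

theorem gen_apply (n : ℕ) (i : Fin n) (s : S n) (b : Fin (n / 2) → Bool) :
    gen n i s b = if h : i.val / 2 < n / 2 then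
          genCoeff i.val ⟨i.val / 2, h⟩ b * s (flipAt ⟨i.val / 2, h⟩ b)
        else Complex.I * jwSign (n / 2) b * s b := rfl

theorem jwSign_mul_self {k : ℕ} (m : ℕ) (b : Fin k → Bool) : jwSign m b * jwSign m b = 1 := by
  unfold jwSign
  rw [← Finset.prod_mul_distrib]
  apply Finset.prod_eq_one
  intro l _
  split_ifs <;> norm_num

theorem flipAt_flipAt {k : ℕ} (m : Fin k) (b : Fin k → Bool) : flipAt m (flipAt m b) = b := by
  funext l; by_cases h : l = m <;> simp [flipAt, Function.update, h]

theorem flipAt_comm {k : ℕ} (m m' : Fin k) (b : Fin k → Bool) :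
    flipAt m (flipAt m' b) = flipAt m' (flipAt m b) := by
  funext l
  by_cases h : l = m <;> by_cases h' : l = m' <;> simp [flipAt, Function.update] <;> grind

theorem jwSign_flip {k : ℕ} (m : ℕ) (m' : Fin k) (b : Fin k → Bool) :
    jwSign m (flipAt m' b) = if m'.val < m then -jwSign m b else jwSign m b := by
  unfold jwSign
  rw [← Finset.mul_prod_erase _ _ (Finset.mem_univ m'),
    ← Finset.mul_prod_erase (Finset.univ) (fun l => if l.val < m ∧ b l = true then (-1 : ℂ) else 1)
      (Finset.mem_univ m')]
  have : ∀ l ∈ Finset.univ.erase m', (if l.val < m ∧ flipAt m' b l = true then (-1 : ℂ) else 1)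
      = if l.val < m ∧ b l = true then (-1 : ℂ) else 1 := by
    intro l hl
    have : l ≠ m' := (Finset.mem_erase.1 hl).1
    simp [flipAt, Function.update, this]
  rw [Finset.prod_congr rfl this]
  by_cases h : m'.val < m <;> cases hb : b m' <;> simp [flipAt, h, hb]

theorem genCoeff_mul_self {k : ℕ} (i j : ℕ) (m : Fin k) (b : Fin k → Bool) (h : i % 2 = j % 2) :
    genCoeff i m b * genCoeff j m (flipAt m b) = -1 := by
  have h1 := jwSign_mul_self m.val b
  have h2 : flipAt m b m = !b m := by simp [flipAt]
  simp only [genCoeff, jwSign_flip, lt_irrefl, if_false, h2, h]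
  rcases Nat.mod_two_eq_zero_or_one j with h' | h' <;> cases hb : b m <;> simp [h'] <;>
    first
    | linear_combination (-1 : ℂ) * h1 + jwSign m.val b ^ 2 * Complex.I_sq
    | linear_combination (-1 : ℂ) * h1
    | linear_combination h1

theorem genCoeff_anticomm {k : ℕ} (i j : ℕ) (m : Fin k) (b : Fin k → Bool) (h : i % 2 ≠ j % 2) :
    genCoeff i m b * genCoeff j m (flipAt m b) + genCoeff j m b * genCoeff i m (flipAt m b) = 0 := by
  have h2 : flipAt m b m = !b m := by simp [flipAt]
  simp only [genCoeff, jwSign_flip, lt_irrefl, if_false, h2]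
  rcases Nat.mod_two_eq_zero_or_one j with h' | h' <;>
  rcases Nat.mod_two_eq_zero_or_one i with h'' | h'' <;> cases hb : b m <;> simp [h', h''] <;>
    first | omega | ring

theorem genCoeff_anticomm' {k : ℕ} (i j : ℕ) (m m' : Fin k) (b : Fin k → Bool) (h : m ≠ m') :
    genCoeff i m b * genCoeff j m' (flipAt m b) + genCoeff j m' b * genCoeff i m (flipAt m' b) = 0 := by
  have h2 : flipAt m b m' = b m' := by simp [flipAt, Function.update, h.symm]
  have h3 : flipAt m' b m = b m := by simp [flipAt, Function.update, h]
  have h4 : m.val ≠ m'.val := fun h' => h (Fin.ext h')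
  simp only [genCoeff, jwSign_flip, h2, h3]
  rcases lt_or_gt_of_ne h4 with h5 | h5
  · simp only [h5, not_lt_of_gt h5, if_true, if_false]; ring
  · simp only [h5, not_lt_of_gt h5, if_true, if_false]; ring

theorem genCoeff_jwSign {k : ℕ} (i : ℕ) (m : Fin k) (b : Fin k → Bool) :
    genCoeff i m b * jwSign k (flipAt m b) + jwSign k b * genCoeff i m b = 0 := by
  simp only [jwSign_flip, m.isLt, if_true]; ring

theorem gen_anticomm (n : ℕ) (i j : Fin n) :
    gen n i * gen n j + gen n j * gen n i = (if i = j then (-2 : ℂ) else 0) • 1 := by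
  ext s b
  change gen n i (gen n j s) b + gen n j (gen n i s) b = (if i = j then (-2 : ℂ) else 0) * s b
  simp only [gen_apply]
  by_cases hi : i.val / 2 < n / 2 <;> by_cases hj : j.val / 2 < n / 2 <;>
    simp only [hi, hj, dif_pos, dif_neg, not_false_eq_true]
  · by_cases hm : i.val / 2 = j.val / 2
    · have hm' : (⟨j.val / 2, hj⟩ : Fin (n / 2)) = ⟨i.val / 2, hi⟩ := Fin.ext hm.symm
      rw [hm', flipAt_flipAt]
      by_cases hij : i = j
      · subst hij
        have := genCoeff_mul_self i.val i.val ⟨i.val / 2, hi⟩ b rfl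
        simp only [if_true]
        linear_combination (2 * s b) * this
      · have hp : i.val % 2 ≠ j.val % 2 := fun h => hij (Fin.ext (by omega))
        have := genCoeff_anticomm i.val j.val ⟨i.val / 2, hi⟩ b hp
        simp only [hij, if_false]
        linear_combination (s b) * this
    · have hij : i ≠ j := fun h => hm (by rw [h])
      have hne : (⟨i.val / 2, hi⟩ : Fin (n / 2)) ≠ ⟨j.val / 2, hj⟩ :=
        fun h => hm (congrArg Fin.val h)
      have := genCoeff_anticomm' i.val j.val _ _ b hne
      rw [flipAt_comm ⟨j.val / 2, hj⟩ ⟨i.val / 2, hi⟩]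
      simp only [hij, if_false]
      linear_combination (s (flipAt ⟨i.val / 2, hi⟩ (flipAt ⟨j.val / 2, hj⟩ b))) * this
  · have hij : i ≠ j := fun h => hj (by rw [← h]; exact hi)
    have := genCoeff_jwSign i.val ⟨i.val / 2, hi⟩ b
    simp only [hij, if_false]
    linear_combination (Complex.I * s (flipAt ⟨i.val / 2, hi⟩ b)) * this
  · have hij : i ≠ j := fun h => hi (by rw [h]; exact hj)
    have := genCoeff_jwSign j.val ⟨j.val / 2, hj⟩ b
    simp only [hij, if_false]
    linear_combination (Complex.I * s (flipAt ⟨j.val / 2, hj⟩ b)) * this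
  · have hij : i = j := Fin.ext (by omega)
    have := jwSign_mul_self (n / 2) b
    simp only [hij, if_true]
    linear_combination (-2 * s b) * this + (2 * jwSign (n / 2) b ^ 2 * s b) * Complex.I_sq

/-- Clifford multiplication `c(v)` of a vector on spinors. -/
def cliff (n : ℕ) : E n →ₗ[ℝ] (S n →L[ℂ] S n) where
  toFun v := ∑ i, (v i : ℂ) • gen n i
  map_add' v w := by
    rw [← Finset.sum_add_distrib]
    refine Finset.sum_congr rfl fun i _ => ?_
    rw [PiLp.add_apply, Complex.ofReal_add]
    exact add_smul (v i : ℂ) (w i : ℂ) (gen n i)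
  map_smul' c v := by
    ext s b
    simp [Finset.mul_sum, mul_assoc]

theorem cliff_mul_self (n : ℕ) (v : E n) :
    cliff n v * cliff n v = algebraMap ℝ (S n →L[ℂ] S n) (Q n v) := by
  have h1 : cliff n v * cliff n v = ∑ i, ∑ j, ((v i : ℂ) * v j) • (gen n i * gen n j) := by
    simp only [cliff, LinearMap.coe_mk, AddHom.coe_mk, Finset.sum_mul, Finset.mul_sum,
      smul_mul_smul_comm]
    exact Finset.sum_comm
  have h2 : cliff n v * cliff n v = ∑ i, ∑ j, ((v i : ℂ) * v j) • (gen n j * gen n i) := by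
    rw [h1, Finset.sum_comm]
    exact Finset.sum_congr rfl fun i _ => Finset.sum_congr rfl fun j _ => by
      rw [mul_comm (v j : ℂ)]
  have h4 : algebraMap ℝ (S n →L[ℂ] S n) (Q n v) = (∑ i, -((v i : ℂ) * v i)) • 1 := by
    rw [Algebra.algebraMap_eq_smul_one, Q_apply, PiLp.inner_apply]
    ext s b
    simp [pow_two]
  have h3 : (2 : ℂ) • (cliff n v * cliff n v) = (2 : ℂ) • (∑ i, -((v i : ℂ) * v i)) • 1 := by
    refine (two_smul ℂ (cliff n v * cliff n v)).trans ?_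
    nth_rw 1 [h1]
    rw [h2, ← Finset.sum_add_distrib]
    have : ∀ i, (∑ j, ((v i : ℂ) * v j) • (gen n i * gen n j)) +
        ∑ j, ((v i : ℂ) * v j) • (gen n j * gen n i) =
          (2 * -((v i : ℂ) * v i)) • (1 : S n →L[ℂ] S n) := by
      intro i
      have aux : ∀ (c : ℂ) (X Y : S n →L[ℂ] S n), c • X + c • Y = c • (X + Y) :=
        fun c X Y => (smul_add c X Y).symm
      rw [← Finset.sum_add_distrib, Finset.sum_eq_single i]
      · rw [aux, gen_anticomm, if_pos rfl, smul_smul]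
        congr 1
        ring
      · intro j _ hj
        rw [aux, gen_anticomm, if_neg hj.symm]
        ext s b
        simp
      · simp
    rw [Finset.sum_congr rfl fun i _ => this i, ← Finset.sum_smul, ← Finset.mul_sum, smul_smul]
  rw [h4]
  exact smul_right_injective _ (two_ne_zero : (2 : ℂ) ≠ 0) h3

/-- The spinor representation of the Clifford algebra (and so of `Spin(n)`) on `S`. -/
def spinorRep (n : ℕ) : CliffordAlgebra (Q n) →ₐ[ℝ] (S n →L[ℂ] S n) :=
  CliffordAlgebra.lift (Q n) ⟨cliff n, cliff_mul_self n⟩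

/-- A linear left inverse of the inclusion `ℝⁿ → Cl(ℝⁿ)`. -/
def vecPart (n : ℕ) : CliffordAlgebra (Q n) →ₗ[ℝ] E n :=
  ExteriorAlgebra.ιInv ∘ₗ (CliffordAlgebra.equivExterior (Q n)).toLinearMap

theorem vecPart_ι {n : ℕ} (v : E n) : vecPart n (CliffordAlgebra.ι (Q n) v) = v := by
  simp [vecPart, CliffordAlgebra.equivExterior, ExteriorAlgebra.ιInv]

/-- The vector representation `Spin(n) → SO(n)`, `v ↦ g v g⁻¹`. -/
def spinAd {n : ℕ} (g : Spin n) : E n →L[ℝ] E n :=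
  LinearMap.toContinuousLinearMap
    (vecPart n ∘ₗ LinearMap.mulLeft ℝ (g : CliffordAlgebra (Q n)) ∘ₗ
      LinearMap.mulRight ℝ ((g⁻¹ : Spin n) : CliffordAlgebra (Q n)) ∘ₗ CliffordAlgebra.ι (Q n))

theorem ι_spinAd {n : ℕ} (g : Spin n) (v : E n) :
    CliffordAlgebra.ι (Q n) (spinAd g v) =
      (g : CliffordAlgebra (Q n)) * CliffordAlgebra.ι (Q n) v *
        ((g⁻¹ : Spin n) : CliffordAlgebra (Q n)) := by
  obtain ⟨w, hw⟩ := spinGroup.conjAct_smul_ι_mem_range_ι (x := spinGroup.toUnits g) g.2 v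
  have hw' : CliffordAlgebra.ι (Q n) w = (g : CliffordAlgebra (Q n)) * CliffordAlgebra.ι (Q n) v *
        ((g⁻¹ : Spin n) : CliffordAlgebra (Q n)) := by
    rw [hw, ConjAct.units_smul_def]; rfl
  have : spinAd g v = w := by
    simp [spinAd, ← mul_assoc, ← hw', vecPart_ι]
  rw [this, hw']

/-- The product of two unit vectors lies in `Spin(n)`. -/
theorem unit_mul_unit_mem {n : ℕ} (u v : E n) (hu : inner ℝ u u = (1 : ℝ))
    (hv : inner ℝ v v = (1 : ℝ)) :
    CliffordAlgebra.ι (Q n) u * CliffordAlgebra.ι (Q n) v ∈ spinGroup (Q n) := by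
  have key : ∀ w : E n, inner ℝ w w = (1 : ℝ) →
      CliffordAlgebra.ι (Q n) w * CliffordAlgebra.ι (Q n) w = -1 := by
    intro w hw
    rw [CliffordAlgebra.ι_sq_scalar, Q_apply, hw]
    simp
  let x : (w : E n) → inner ℝ w w = (1 : ℝ) → (CliffordAlgebra (Q n))ˣ := fun w hw =>
    ⟨CliffordAlgebra.ι (Q n) w, -CliffordAlgebra.ι (Q n) w, by simp [key w hw], by simp [key w hw]⟩
  have hx : ∀ w hw, x w hw ∈ lipschitzGroup (Q n) := fun w hw => Subgroup.subset_closure ⟨w, rfl⟩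
  have hs : ∀ a b : CliffordAlgebra (Q n), b * b = -1 → a * a = -1 → a * b * (b * a) = 1 := by
    intro a b hb ha
    rw [mul_assoc, ← mul_assoc b b a, hb]
    simp [ha]
  refine ⟨⟨⟨x u hu * x v hv, mul_mem (hx u hu) (hx v hv), rfl⟩, ?_⟩, ?_⟩
  · refine Unitary.mem_iff.2 ?_
    simp only [star_mul, CliffordAlgebra.star_ι, neg_mul_neg]
    exact ⟨hs _ _ (key u hu) (key v hv), hs _ _ (key v hv) (key u hu)⟩
  · exact CliffordAlgebra.ι_mul_ι_mem_evenOdd_zero (Q n) u v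

/-- The standard maximal torus of `Spin(n)`: `cos(θ/2) + sin(θ/2) e_{2m} e_{2m+1}` covers the
rotation by `θ` in the plane spanned by `e_{2m}` and `e_{2m+1}` (indices start from `0`). -/
def torus {n : ℕ} (m : Fin (n / 2)) (θ : ℝ) : Spin n :=
  ⟨algebraMap ℝ _ (Real.cos (θ / 2)) + Real.sin (θ / 2) •
      (CliffordAlgebra.ι (Q n) (e ⟨2 * m.val, by omega⟩) *
        CliffordAlgebra.ι (Q n) (e ⟨2 * m.val + 1, by omega⟩)), by
    have hne : (⟨2 * m.val, by omega⟩ : Fin n) ≠ ⟨2 * m.val + 1, by omega⟩ := by simp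
    have h := unit_mul_unit_mem (e ⟨2 * m.val, by omega⟩)
      (-Real.cos (θ / 2) • e ⟨2 * m.val, by omega⟩ +
        Real.sin (θ / 2) • e (⟨2 * m.val + 1, by omega⟩ : Fin n)) (by simp [e])
      (by
        simp only [e, inner_add_left, inner_add_right, real_inner_smul_left, real_inner_smul_right,
          EuclideanSpace.inner_single_left, PiLp.single_apply, hne, hne.symm]
        simp
        nlinarith [Real.sin_sq_add_cos_sq (θ / 2)])
    convert h using 1
    rw [map_add, map_smul, map_smul, mul_add, mul_smul_comm, mul_smul_comm,
      CliffordAlgebra.ι_sq_scalar, Q_apply]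
    simp [e, Algebra.algebraMap_eq_smul_one]⟩

/-! ## Spinor valued alternating forms and their decomposition under `Spin(n)` -/

/-- The representation space `Λᵏ(ℂⁿ) ⊗ S`, as the space of alternating `k`-forms on `ℝⁿ` with values
in `S`. -/
abbrev F (n k : ℕ) := E n [⋀^Fin k]→L[ℝ] S n

/-- The action of `Spin(n)` on `Λᵏ(ℂⁿ) ⊗ S`. -/
def act {n k : ℕ} (g : Spin n) (η : F n k) : F n k :=
  ((spinorRep n g).restrictScalars ℝ).compContinuousAlternatingMap
    (η.compContinuousLinearMap (spinAd g⁻¹))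

theorem act_add {n k : ℕ} (g : Spin n) (η ζ : F n k) : act g (η + ζ) = act g η + act g ζ := by
  ext y
  simp [act]

theorem act_smul {n k : ℕ} (g : Spin n) (c : ℂ) (η : F n k) : act g (c • η) = c • act g η := by
  ext y
  simp [act]

/-- A complex subspace of `Λᵏ(ℂⁿ) ⊗ S` that is stable under `Spin(n)`. -/
def IsInvariant {n k : ℕ} (W : Submodule ℂ (F n k)) : Prop :=
  ∀ g : Spin n, ∀ η ∈ W, act g η ∈ W

/-- An irreducible `Spin(n)`-subrepresentation of `Λᵏ(ℂⁿ) ⊗ S`. -/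
def IsIrreducible {n k : ℕ} (W : Submodule ℂ (F n k)) : Prop :=
  IsInvariant W ∧ W ≠ ⊥ ∧ ∀ W' ≤ W, IsInvariant W' → W' = ⊥ ∨ W' = W

/-- `η` is a weight vector of weight `μ` for the standard maximal torus. -/
def IsWeightVector {n k : ℕ} (μ : Fin (n / 2) → ℝ) (η : F n k) : Prop :=
  η ≠ 0 ∧ ∀ (m : Fin (n / 2)) (θ : ℝ),
    act (torus m θ) η = Complex.exp (((μ m * θ : ℝ) : ℂ) * Complex.I) • η

/-- `μ` is the highest weight of `W`: it is a weight of `W`, and every weight of `W` is at most `μ`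
in the lexicographic order. -/
def HasHighestWeight {n k : ℕ} (W : Submodule ℂ (F n k)) (μ : Fin (n / 2) → ℝ) : Prop :=
  (∃ η ∈ W, IsWeightVector μ η) ∧
    ∀ ν : Fin (n / 2) → ℝ, (∃ η ∈ W, IsWeightVector ν η) → toLex ν ≤ toLex μ

/-- The weight `λ_j = (3/2, …, 3/2, 1/2, …, 1/2)` with `j` entries `3/2`. -/
def wt (n j : ℕ) : Fin (n / 2) → ℝ := fun m => if m.val < j then 3 / 2 else 1 / 2

/-- The weight `λ_j⁻`: as `λ_j`, with the sign of the last entry reversed. -/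
def wtNeg (n j : ℕ) : Fin (n / 2) → ℝ := fun m =>
  if m.val + 1 = n / 2 then -wt n j m else wt n j m

/-- `W` has highest weight `λ_j` or, if `n` is even, `λ_j⁺ = λ_j` or `λ_j⁻`. -/
def HasType {n k : ℕ} (j : ℕ) (W : Submodule ℂ (F n k)) : Prop :=
  HasHighestWeight W (wt n j) ∨ (Even n ∧ HasHighestWeight W (wtNeg n j))

/-- The component `E^{k,j}` of `Λᵏ(ℂⁿ) ⊗ S`: the sum of all irreducible subrepresentations with
highest weight `λ_j` (`λ_j⁺` or `λ_j⁻` if `n` is even). -/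
def comp (n k j : ℕ) : Submodule ℂ (F n k) :=
  sSup {W | IsIrreducible W ∧ HasType j W}

/-- The sum of all other irreducible subrepresentations of `Λᵏ(ℂⁿ) ⊗ S`. -/
def coComp (n k j : ℕ) : Submodule ℂ (F n k) :=
  sSup {W | IsIrreducible W ∧ ¬ HasType j W}

open Classical in
/-- The projection `π_{k,j}` of `Λᵏ(ℂⁿ) ⊗ S` onto `E^{k,j}` along the sum of the other irreducible
components. (The two subspaces are always complementary, as `Spin(n)` is compact.) -/
def proj (n k j : ℕ) : F n k →ₗ[ℂ] F n k :=
  if h : IsCompl (comp n k j) (coComp n k j) then (comp n k j).projection (coComp n k j) h else 0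

/-- Outer multiplication `ε(v) η = v ∧ η` by a complex covector `v`. -/
def outerMul {n k : ℕ} (v : E n →L[ℝ] ℂ) (η : F n k) : F n (k + 1) :=
  ContinuousAlternatingMap.alternatizeUncurryFin (v.smulRight η)

/-- The decomposable element `v_1 ∧ … ∧ v_k ⊗ s`. -/
def wedge {n : ℕ} : (k : ℕ) → (Fin k → (E n →L[ℝ] ℂ)) → S n → F n k
  | 0, _, s => ContinuousAlternatingMap.constOfIsEmpty ℝ (E n) (Fin 0) s
  | k + 1, v, s => outerMul (v 0) (wedge k (fun i => v i.succ) s)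

/-- The covector `x ↦ x_{2m} - i x_{2m+1}`, a weight vector of `ℂⁿ` with the single nonzero weight
`1` in the place `m` (places are counted from `0`). -/
def nullCovector {n : ℕ} (m : Fin (n / 2)) : E n →L[ℝ] ℂ :=
  Complex.ofRealCLM ∘L EuclideanSpace.proj (⟨2 * m.val, by omega⟩ : Fin n) -
    Complex.I • (Complex.ofRealCLM ∘L EuclideanSpace.proj (⟨2 * m.val + 1, by omega⟩ : Fin n))

/-- The vacuum spinor `s_0`, a weight vector of `S` of the highest weight `(1/2, …, 1/2)`. -/
def vacuum (n : ℕ) : S n := EuclideanSpace.single (fun _ => false) 1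

/-- `v_1 ∧ … ∧ v_j ⊗ s_0`. -/
def hwVector {n j : ℕ} (hj : j ≤ n / 2) : F n j :=
  wedge j (fun a => nullCovector ⟨a.val, a.isLt.trans_le hj⟩) (vacuum n)

/-- The map `η ↦ π_{j+1,j+1} (v ∧ η)` on the model representation. -/
def modelSymbol (n j : ℕ) (v : E n →L[ℝ] ℂ) (η : F n j) : F n (j + 1) :=
  proj n (j + 1) (j + 1) (outerMul v η)

/-- The element of the Lie algebra `spin(n)`, acting on `S`, that covers the skew-symmetric
endomorphism `A` of `ℝⁿ`: it is `¼ ∑_j e_j · A e_j`. -/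
def spinLift {n : ℕ} (A : E n →L[ℝ] E n) : S n →L[ℂ] S n :=
  (1 / 4 : ℝ) • ∑ j, gen n j * cliff n (A (e j))

/-- The action of a skew-symmetric `A` (an element of `so(n) = spin(n)`) on `Λᵏ(ℂⁿ) ⊗ S`:
`(A η)(x_1, …, x_k) = Ã (η(x_1, …, x_k)) - ∑_i η(x_1, …, A x_i, …, x_k)`, `Ã` the lift of `A`. -/
def infAct {n k : ℕ} (A : E n →L[ℝ] E n) (η : F n k) : F n k :=
  ((spinLift A).restrictScalars ℝ).compContinuousAlternatingMap η -
    η.fderivCompContinuousLinearMap (ContinuousLinearMap.id ℝ (E n)) A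

theorem infAct_add {n k : ℕ} (A : E n →L[ℝ] E n) (η ζ : F n k) :
    infAct A (η + ζ) = infAct A η + infAct A ζ := by
  ext y
  simp [infAct, Finset.sum_add_distrib]
  ring

theorem infAct_smul {n k : ℕ} (A : E n →L[ℝ] E n) (c : ℂ) (η : F n k) :
    infAct A (c • η) = c • infAct A η := by
  ext y
  simp only [infAct, ContinuousAlternatingMap.sub_apply, ContinuousAlternatingMap.smul_apply,
    ContinuousAlternatingMap.fderivCompContinuousLinearMap_apply, PiLp.sub_apply, PiLp.smul_apply,
    ← Finset.smul_sum, smul_sub]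
  simp

/-! ## Riemannian spin manifolds, associated bundles and the operators `T_j` -/

/-- An orientation together with a spin structure on a Riemannian manifold `M` of dimension `n`,
given by an open cover with smooth local orthonormal frames and lifts to `Spin(n)` of the transition
functions between them that satisfy the cocycle condition. The principal `Spin(n)`-bundle is
the one glued from these transition functions. (Smoothness of a map into `Spin(n)` is tested in the
faithful representation on `S`.) -/
structure SpinStructure (n : ℕ) (M : Type*) [TopologicalSpace M] [ChartedSpace (E n) M]
    [IsManifold (𝓡 n) ∞ M] [RiemannianBundle (fun x : M => TangentSpace (𝓡 n) x)] (A : Type*) where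
  /-- the open cover -/
  U : A → Set M
  isOpen_U : ∀ α, IsOpen (U α)
  cover : ∀ x, ∃ α, x ∈ U α
  /-- the local frames -/
  frame : A → Fin n → (x : M) → TangentSpace (𝓡 n) x
  frame_smooth : ∀ α i, ContMDiffOn (𝓡 n) (𝓡 n).tangent ∞
    (fun x => (⟨x, frame α i x⟩ : TangentBundle (𝓡 n) M)) (U α)
  frame_orthonormal : ∀ α, ∀ x ∈ U α, ∀ i j,
    inner ℝ (frame α i x) (frame α j x) = if i = j then (1 : ℝ) else 0
  /-- the transition functions -/
  g : A → A → M → Spin n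
  g_smooth : ∀ α β, ContMDiffOn (𝓡 n) 𝓘(ℝ, S n →L[ℂ] S n) ∞
    (fun x => spinorRep n (g α β x)) (U α ∩ U β)
  g_frame : ∀ α β, ∀ x ∈ U α ∩ U β, ∀ j,
    frame β j x = ∑ i, (spinAd (g α β x) (e j)) i • frame α i x
  cocycle : ∀ α β γ, ∀ x ∈ U α ∩ U β ∩ U γ, g α β x * g β γ x = g α γ x

namespace SpinStructure

variable {n : ℕ} {M : Type*} [TopologicalSpace M] [ChartedSpace (E n) M]
  [IsManifold (𝓡 n) ∞ M] [RiemannianBundle (fun x : M => TangentSpace (𝓡 n) x)] {A : Type*}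

/-- Smooth sections of the vector bundle associated with a subrepresentation `V` of `Λᵏ(ℂⁿ) ⊗ S`:
families of local representatives `s α : U α → V` (extended by `0` outside `U α`) with
`s α = g α β · s β` on overlaps. -/
def sections (P : SpinStructure n M A) {k : ℕ} (V : Submodule ℂ (F n k)) :
    Submodule ℂ (A → M → F n k) where
  carrier := {s |
    (∀ α, ContMDiffOn (𝓡 n) 𝓘(ℝ, F n k) ∞ (s α) (P.U α)) ∧
    (∀ α, ∀ x ∈ P.U α, s α x ∈ V) ∧
    (∀ α, ∀ x ∉ P.U α, s α x = 0) ∧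
    (∀ α β, ∀ x ∈ P.U α ∩ P.U β, s α x = act (P.g α β x) (s β x))}
  add_mem' := by
    rintro s t ⟨hs1, hs2, hs3, hs4⟩ ⟨ht1, ht2, ht3, ht4⟩
    refine ⟨fun α => (hs1 α).add (ht1 α), fun α x hx => V.add_mem (hs2 α x hx) (ht2 α x hx),
      fun α x hx => ?_, fun α β x hx => ?_⟩
    · simp [hs3 α x hx, ht3 α x hx]
    · simp only [Pi.add_apply, hs4 α β x hx, ht4 α β x hx, act_add]
  zero_mem' := by
    refine ⟨fun α => contMDiffOn_const, fun α x hx => V.zero_mem, fun α x hx => rfl,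
      fun α β x hx => ?_⟩
    ext y
    simp [act]
  smul_mem' := by
    rintro c s ⟨hs1, hs2, hs3, hs4⟩
    refine ⟨fun α => ?_, fun α x hx => V.smul_mem c (hs2 α x hx), fun α x hx => ?_,
      fun α β x hx => ?_⟩
    · exact ((c • ContinuousLinearMap.id ℝ (F n k)).contMDiff.comp_contMDiffOn (hs1 α))
    · simp [hs3 α x hx]
    · simp only [Pi.smul_apply, hs4 α β x hx, act_smul]

/-- The connection coefficients `⟨∇_{e_k} e_j, e_i⟩` of the Levi-Civita connection in the
orthonormal frame `e = frame α`, by the Koszul formula. -/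
def conn (P : SpinStructure n M A) (α : A) (k j i : Fin n) (x : M) : ℝ :=
  (1 / 2 : ℝ) *
    (inner ℝ (VectorField.mlieBracket (𝓡 n) (P.frame α k) (P.frame α j) x) (P.frame α i x)
      - inner ℝ (VectorField.mlieBracket (𝓡 n) (P.frame α j) (P.frame α i) x) (P.frame α k x)
      + inner ℝ (VectorField.mlieBracket (𝓡 n) (P.frame α i) (P.frame α k) x) (P.frame α j x))

/-- The value `ω(e_k) ∈ so(n)` of the Levi-Civita connection form in the frame `α`:
it maps `e_j` to `∑_i ⟨∇_{e_k} e_j, e_i⟩ e_i`. -/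
def connForm (P : SpinStructure n M A) (α : A) (k : Fin n) (x : M) : E n →L[ℝ] E n :=
  ∑ j, ∑ i, P.conn α k j i x •
    (EuclideanSpace.proj (𝕜 := ℝ) j : E n →L[ℝ] ℝ).smulRight (e i : E n)

/-- The covariant derivative, in the direction of the frame vector `e_k`, of a local representative
of a spinor valued form. -/
def covDeriv (P : SpinStructure n M A) (α : A) {k : ℕ} (s : M → F n k) (i : Fin n) (x : M) :
    F n k :=
  mvfderiv (𝓡 n) s x (P.frame α i x) + infAct (P.connForm α i x) (s x)

/-- The covariant exterior derivative `∇^S : Ωᵏ ⊗ S → Ωᵏ⁺¹ ⊗ S`: the alternation of the covariant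
derivative. -/
def extCovDeriv (P : SpinStructure n M A) (α : A) {k : ℕ} (s : M → F n k) (x : M) : F n (k + 1) :=
  ContinuousAlternatingMap.alternatizeUncurryFin
    (∑ i, (EuclideanSpace.proj (𝕜 := ℝ) i : E n →L[ℝ] ℝ).smulRight (P.covDeriv α s i x))

theorem mdifferentiableAt_section (P : SpinStructure n M A) {k : ℕ} {V : Submodule ℂ (F n k)}
    (s : P.sections V) (α : A) {x : M} (hx : x ∈ P.U α) :
    MDifferentiableAt (𝓡 n) 𝓘(ℝ, F n k) (s.1 α) x :=
  ((s.2.1 α).contMDiffAt ((P.isOpen_U α).mem_nhds hx)).mdifferentiableAt (by simp)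

theorem extCovDeriv_add (P : SpinStructure n M A) (α : A) {k : ℕ} {s t : M → F n k} {x : M}
    (hs : MDifferentiableAt (𝓡 n) 𝓘(ℝ, F n k) s x) (ht : MDifferentiableAt (𝓡 n) 𝓘(ℝ, F n k) t x) :
    P.extCovDeriv α (s + t) x = P.extCovDeriv α s x + P.extCovDeriv α t x := by
  have : ∀ i, P.covDeriv α (s + t) i x = P.covDeriv α s i x + P.covDeriv α t i x := by
    intro i
    simp only [covDeriv, mvfderiv_add hs ht, Pi.add_apply, infAct_add, add_apply]
    abel
  rw [extCovDeriv, extCovDeriv, extCovDeriv, ← ContinuousAlternatingMap.alternatizeUncurryFin_add]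
  congr 1
  ext v y
  simp [this, Finset.sum_add_distrib]

theorem extCovDeriv_smul (P : SpinStructure n M A) (α : A) {k : ℕ} (c : ℂ) {s : M → F n k} {x : M}
    (hs : MDifferentiableAt (𝓡 n) 𝓘(ℝ, F n k) s x) :
    P.extCovDeriv α (c • s) x = c • P.extCovDeriv α s x := by
  have : ∀ i, P.covDeriv α (c • s) i x = c • P.covDeriv α s i x := by
    intro i
    have h : mvfderiv (𝓡 n) (c • s) x (P.frame α i x) =
        c • mvfderiv (𝓡 n) s x (P.frame α i x) := by
      have h1 := hs.hasMFDerivAt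
      have h2 := (c • ContinuousLinearMap.id ℝ (F n k)).hasMFDerivAt (x := s x)
      have h3 := (h2.comp x h1).mfderiv
      have h4 := congrArg (fun L => L (P.frame α i x)) h3
      exact h4
    simp only [covDeriv, h, Pi.smul_apply, infAct_smul, smul_add]
  rw [extCovDeriv, extCovDeriv, ← ContinuousAlternatingMap.alternatizeUncurryFin_smul]
  congr 1
  ext v y
  simp [this, Finset.mul_sum]
  exact Finset.sum_congr rfl fun i _ => by ring

open Classical in
/-- The first order operator `T_j = π_{j+1,j+1} ∘ ∇^S` on sections of `E^{j,j}`; the value is given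
by its local representatives. -/
def T (P : SpinStructure n M A) (j : ℕ) :
    P.sections (comp n j j) →ₗ[ℂ] (A → M → F n (j + 1)) where
  toFun s := fun α x =>
    if x ∈ P.U α then proj n (j + 1) (j + 1) (P.extCovDeriv α (s.1 α) x) else 0
  map_add' s t := by
    funext α x
    by_cases hx : x ∈ P.U α
    · have h := P.extCovDeriv_add α (P.mdifferentiableAt_section s α hx)
        (P.mdifferentiableAt_section t α hx)
      simp only [Pi.add_apply, if_pos hx]
      rw [← map_add, ← h]
      rfl
    · simp [hx]
  map_smul' c s := by
    funext α x
    by_cases hx : x ∈ P.U α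
    · have h := P.extCovDeriv_smul α c (P.mdifferentiableAt_section s α hx)
      simp only [Pi.smul_apply, if_pos hx, RingHom.id_apply]
      rw [← map_smul, ← h]
      rfl
    · simp only [Pi.smul_apply, if_neg hx]
      exact (smul_zero (A := F n (j + 1)) c).symm

/-- The components in the frame `α` of a complex covector `ξ` at `x`, as a covector on `ℝⁿ`. -/
def frameCovector (P : SpinStructure n M A) (α : A) (x : M) (ξ : TangentSpace (𝓡 n) x →L[ℝ] ℂ) :
    E n →L[ℝ] ℂ :=
  ∑ i, (EuclideanSpace.proj (𝕜 := ℝ) i : E n →L[ℝ] ℝ).smulRight (ξ (P.frame α i x))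

/-- The map `σ(ξ) η = π_{j+1,j+1} (ξ ∧ η)`, for a covector `ξ` at `x`, in the frame `α`. -/
def symbol (P : SpinStructure n M A) (j : ℕ) (α : A) (x : M)
    (ξ : TangentSpace (𝓡 n) x →L[ℝ] ℂ) (η : F n j) : F n (j + 1) :=
  modelSymbol n j (P.frameCovector α x ξ) η

/-- `σ` is the principal symbol of the first order operator `D`:
`D (f s) - f D s = σ(df) s` for all smooth complex functions `f` and all sections `s`. -/
def HasPrincipalSymbol (P : SpinStructure n M A) {k l : ℕ} {V : Submodule ℂ (F n k)}
    (D : P.sections V →ₗ[ℂ] (A → M → F n l))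
    (σ : (α : A) → (x : M) → (TangentSpace (𝓡 n) x →L[ℝ] ℂ) → F n k → F n l) : Prop :=
  ∀ f : M → ℂ, ContMDiff (𝓡 n) 𝓘(ℝ, ℂ) ∞ f → ∀ s t : P.sections V,
    (∀ α x, t.1 α x = f x • s.1 α x) →
    ∀ α, ∀ x ∈ P.U α, D t α x - f x • D s α x = σ α x (mvfderiv (𝓡 n) f x) (s.1 α x)

end SpinStructure

end SpinForms

end

noncomputable section

namespace SpinForms

/-! ## Unitarity of the spinor representation and orthogonality of the vector representation -/

/-! The covariant derivative is the differential plus a complex-linear zeroth-order term, so by the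
Leibniz rule `extCovDeriv` of `f • s` differs from `f` times that of `s` by `df ∧ s`. Applying
`proj`, which is linear, gives the symbol.

Nontriviality is a highest weight argument. `λ_j` is lexicographically the largest weight occurring
anywhere in `Λʲ(ℂⁿ) ⊗ S` (`IsWeightVector.toLex_le`): the spinor contributes at most `1/2` in each
place, and a `j`-form contributes at most `1` in each place and can do so in at most `j` places. An
equivariant projection preserves weights, so a vector of weight `λ_j` has no component in an
irreducible summand of another type, since `λ_j` would be the highest weight of that summand as well
(`mem_comp_of_isWeightVector`). Hence `v_1 ∧ … ∧ v_j ⊗ s_0` lies in `E^{j,j}`. Wedging it with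
`v_{j+1}` gives, up to sign, the corresponding vector in degree `j + 1`, which `π_{j+1,j+1}` fixes
(`modelSymbol_hwVector`). As `v_{j+1}` is a complex combination of two real coordinate covectors,
the symbol is nonzero on one of these.

This needs `proj` to be a genuine projection and not its default value `0`. Complementarity
(`isCompl_comp_coComp`) comes from an explicit invariant Hermitian product, so no averaging over the
group is needed.

For the kernel, take a section equal to the highest weight vector at a point `x`, in a
trivialization, and a function `f` with `df = ξ` at `x`. If `T_j` vanished identically, the symbol
formula would give `σ(ξ) η = 0` for every such `ξ`. -/

theorem star_jwSign {k : ℕ} (m : ℕ) (b : Fin k → Bool) : star (jwSign m b) = jwSign m b := by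
  simp only [jwSign, star_prod, apply_ite star, star_neg, star_one]

/-- The matrix of a flipping generator has entries `genCoeff i m b` at `(b, flipAt m b)` only, so
this identity says that the matrix is skew-Hermitian. -/
theorem star_genCoeff_flipAt {k : ℕ} (i : ℕ) (m : Fin k) (b : Fin k → Bool) :
    star (genCoeff i m (flipAt m b)) = -genCoeff i m b := by
  have h2 : flipAt m b m = !b m := by simp [flipAt]
  simp only [genCoeff, star_mul', star_jwSign, jwSign_flip, lt_irrefl, if_false, h2,
    apply_ite star]
  split_ifs <;> cases hb : b m <;> simp_all

/-- The involution `b ↦ flipAt m b` as a permutation. -/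
def flipEquiv {k : ℕ} (m : Fin k) : Equiv.Perm (Fin k → Bool) :=
  ⟨flipAt m, flipAt m, flipAt_flipAt m, flipAt_flipAt m⟩

theorem inner_gen_left (n : ℕ) (i : Fin n) (s t : S n) :
    inner ℂ (gen n i s) t = -inner ℂ s (gen n i t) := by
  simp only [PiLp.inner_apply, RCLike.inner_apply, gen_apply, ← Finset.sum_neg_distrib,
    starRingEnd_apply]
  by_cases h : i.val / 2 < n / 2
  · simp only [h, dif_pos]
    refine Fintype.sum_equiv (flipEquiv ⟨i.val / 2, h⟩) _ _ fun b => ?_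
    simp only [flipEquiv, Equiv.coe_fn_mk, flipAt_flipAt, star_mul']
    have := star_genCoeff_flipAt i.val ⟨i.val / 2, h⟩ (flipAt ⟨i.val / 2, h⟩ b)
    rw [flipAt_flipAt] at this
    rw [this]
    ring
  · simp only [h, dif_neg, not_false_eq_true]
    refine Finset.sum_congr rfl fun b _ => ?_
    simp only [star_mul', star_jwSign]
    have : star Complex.I = -Complex.I := Complex.conj_I
    rw [this]
    ring

theorem inner_cliff_left {n : ℕ} (v : E n) (s t : S n) :
    inner ℂ (cliff n v s) t = -inner ℂ s (cliff n v t) := by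
  simp only [cliff, LinearMap.coe_mk, AddHom.coe_mk, sum_apply, smul_apply, sum_inner, inner_sum,
    inner_smul_left, inner_smul_right, inner_gen_left, Complex.conj_ofReal, mul_neg,
    Finset.sum_neg_distrib]

/-- Vectors act by skew-Hermitian operators and `star` is the anti-involution with `v ↦ -v`, so
adjoint and `star` agree on generators and hence everywhere. Since `star g = g⁻¹` on `Spin n`,
unitarity follows. -/
theorem inner_spinorRep_left {n : ℕ} (a : CliffordAlgebra (Q n)) (s t : S n) :
    inner ℂ (spinorRep n a s) t = inner ℂ s (spinorRep n (star a) t) := by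
  induction a using CliffordAlgebra.induction generalizing s t with
  | algebraMap r =>
    rw [CliffordAlgebra.star_algebraMap, AlgHom.commutes, Algebra.algebraMap_eq_smul_one]
    simp only [smul_apply, one_apply_eq_self]
    rw [← Complex.coe_smul, ← Complex.coe_smul, inner_smul_left, inner_smul_right,
      Complex.conj_ofReal]
  | ι v =>
    rw [CliffordAlgebra.star_ι, map_neg, spinorRep, CliffordAlgebra.lift_ι_apply,
      inner_cliff_left, neg_apply, inner_neg_right]
  | mul a b ha hb => simp [ha, hb]
  | add a b ha hb =>
    simp only [map_add, star_add, add_apply, inner_add_left, inner_add_right, ha, hb]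

theorem coe_inv_spin {n : ℕ} (g : Spin n) :
    ((g⁻¹ : Spin n) : CliffordAlgebra (Q n)) = star (g : CliffordAlgebra (Q n)) := rfl

theorem inv_mul_coe {n : ℕ} (g : Spin n) :
    ((g⁻¹ : Spin n) : CliffordAlgebra (Q n)) * (g : CliffordAlgebra (Q n)) = 1 :=
  congrArg Subtype.val (inv_mul_cancel g)

theorem mul_inv_coe {n : ℕ} (g : Spin n) :
    (g : CliffordAlgebra (Q n)) * ((g⁻¹ : Spin n) : CliffordAlgebra (Q n)) = 1 :=
  congrArg Subtype.val (mul_inv_cancel g)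

theorem inner_spinorRep_spinorRep {n : ℕ} (g : Spin n) (s t : S n) :
    inner ℂ (spinorRep n g s) (spinorRep n g t) = inner ℂ s t := by
  rw [inner_spinorRep_left, ← coe_inv_spin, ← mul_apply_eq_comp, ← map_mul,
    inv_mul_coe, map_one, one_apply_eq_self]

theorem ι_injective (n : ℕ) : Function.Injective (CliffordAlgebra.ι (Q n)) :=
  Function.LeftInverse.injective vecPart_ι

/-- Trading conjugation for a commutation relation removes the inverse, so torus rotations can be
verified by multiplication in the Clifford algebra. -/
theorem spinAd_eq_of {n : ℕ} (g : Spin n) (v w : E n)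
    (h : (g : CliffordAlgebra (Q n)) * CliffordAlgebra.ι (Q n) v =
      CliffordAlgebra.ι (Q n) w * (g : CliffordAlgebra (Q n))) : spinAd g v = w := by
  apply ι_injective
  rw [ι_spinAd, h, mul_assoc, mul_inv_coe, mul_one]

theorem spinAd_one {n : ℕ} (v : E n) : spinAd (1 : Spin n) v = v :=
  spinAd_eq_of _ _ _ (by simp)

theorem spinAd_mul {n : ℕ} (g h : Spin n) (v : E n) :
    spinAd (g * h) v = spinAd g (spinAd h v) := by
  apply ι_injective
  simp only [ι_spinAd, mul_inv_rev, Submonoid.coe_mul, mul_assoc]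

theorem spinAd_inv_apply {n : ℕ} (g : Spin n) (v : E n) : spinAd g⁻¹ (spinAd g v) = v := by
  rw [← spinAd_mul, inv_mul_cancel, spinAd_one]

/-- `(g v g⁻¹)² = g v² g⁻¹ = v²`, because `v² = Q n v` is a central scalar. -/
theorem norm_spinAd {n : ℕ} (g : Spin n) (v : E n) : ‖spinAd g v‖ = ‖v‖ := by
  have h : Q n (spinAd g v) = Q n v := by
    have h1 : algebraMap ℝ (CliffordAlgebra (Q n)) (Q n (spinAd g v)) =
        algebraMap ℝ (CliffordAlgebra (Q n)) (Q n v) := by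
      rw [← CliffordAlgebra.ι_sq_scalar, ι_spinAd, ← CliffordAlgebra.ι_sq_scalar]
      have := inv_mul_coe g
      calc _ = (g : CliffordAlgebra (Q n)) * CliffordAlgebra.ι (Q n) v *
            (((g⁻¹ : Spin n) : CliffordAlgebra (Q n)) * (g : CliffordAlgebra (Q n))) *
            CliffordAlgebra.ι (Q n) v * ((g⁻¹ : Spin n) : CliffordAlgebra (Q n)) := by
              simp only [mul_assoc]
        _ = (g : CliffordAlgebra (Q n)) *
            algebraMap ℝ (CliffordAlgebra (Q n)) (Q n v) *
              ((g⁻¹ : Spin n) : CliffordAlgebra (Q n)) := by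
            rw [this, mul_one, ← CliffordAlgebra.ι_sq_scalar]; simp only [mul_assoc]
        _ = _ := by
            rw [← Algebra.commutes, mul_assoc, mul_inv_coe, mul_one, CliffordAlgebra.ι_sq_scalar]
    exact (algebraMap ℝ (CliffordAlgebra (Q n))).injective h1
  simp only [Q_apply, real_inner_self_eq_norm_sq, neg_inj] at h
  exact (sq_eq_sq₀ (norm_nonneg _) (norm_nonneg _)).1 h

theorem inner_spinAd {n : ℕ} (g : Spin n) (v w : E n) :
    inner ℝ (spinAd g v) (spinAd g w) = inner ℝ v w :=
  (LinearIsometry.mk (spinAd g).toLinearMap (norm_spinAd g)).inner_map_map v w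

/-! ### The group action on spinor-valued forms -/

theorem act_apply {n k : ℕ} (g : Spin n) (η : F n k) (x : Fin k → E n) :
    act g η x = spinorRep n g (η fun a => spinAd g⁻¹ (x a)) := rfl

theorem act_mul {n k : ℕ} (g h : Spin n) (η : F n k) : act (g * h) η = act g (act h η) := by
  refine ContinuousAlternatingMap.ext fun x => ?_
  simp only [act_apply, mul_inv_rev, spinAd_mul, Submonoid.coe_mul, map_mul]
  rfl

theorem act_one {n k : ℕ} (η : F n k) : act (1 : Spin n) η = η := by
  refine ContinuousAlternatingMap.ext fun x => ?_
  simp only [act_apply, inv_one, spinAd_one, OneMemClass.coe_one, map_one]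
  rfl

theorem act_act_inv {n k : ℕ} (g : Spin n) (η : F n k) : act g (act g⁻¹ η) = η := by
  rw [← act_mul, mul_inv_cancel, act_one]

/-- The action of a group element as a linear map. -/
def actₗ {n k : ℕ} (g : Spin n) : F n k →ₗ[ℂ] F n k where
  toFun := act g
  map_add' := act_add g
  map_smul' := act_smul g

/-! ## The invariant Hermitian product -/

/-- The values of a form on tuples of standard basis vectors. -/
def coords {n k : ℕ} : F n k →ₗ[ℂ] PiLp 2 (fun _ : Fin k → Fin n => S n) where
  toFun η := WithLp.toLp 2 fun I => η fun a => e (I a)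
  map_add' _ _ := rfl
  map_smul' _ _ := rfl

theorem coords_apply {n k : ℕ} (η : F n k) (I : Fin k → Fin n) :
    coords η I = η fun a => e (I a) := rfl

theorem sum_smul_e {n : ℕ} (x : E n) : ∑ i, x i • (e i : E n) = x := by
  have := (EuclideanSpace.basisFun (Fin n) ℝ).sum_repr x
  simpa [e] using this

theorem inner_e_left {n : ℕ} (i : Fin n) (x : E n) : inner ℝ (e i) x = x i := by
  rw [e, EuclideanSpace.inner_single_left, map_one, one_mul]

theorem form_expand {n k : ℕ} (η : F n k) (x : Fin k → E n) :
    η x = ∑ I : Fin k → Fin n, (∏ a, x a (I a)) • η fun a => e (I a) := by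
  conv_lhs => rw [show x = fun a => ∑ i, x a i • (e i : E n) from
    funext fun a => (sum_smul_e (x a)).symm]
  have := η.toMultilinearMap.map_sum (fun a i => x a i • (e i : E n))
  refine this.trans (Finset.sum_congr rfl fun I _ => ?_)
  exact η.toMultilinearMap.map_smul_univ _ _

theorem coords_injective {n k : ℕ} : Function.Injective (coords (n := n) (k := k)) := by
  intro η ζ h
  refine ContinuousAlternatingMap.ext fun x => ?_
  rw [form_expand η, form_expand ζ]
  refine Finset.sum_congr rfl fun I _ => ?_
  rw [← coords_apply, ← coords_apply, h]

instance {n k : ℕ} : FiniteDimensional ℂ (F n k) :=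
  Module.Finite.of_injective coords coords_injective

/-- The Hermitian product `∑_I ⟨η(e_I), ζ(e_I)⟩`. -/
def ip {n k : ℕ} (η ζ : F n k) : ℂ := inner ℂ (coords η) (coords ζ)

/-- The transpose of the matrix of `g` is the matrix of `g⁻¹`, so orthonormality of the rows is
orthonormality of the columns for `g⁻¹`. -/
theorem sum_spinAd {n : ℕ} (g : Spin n) (i j : Fin n) :
    ∑ l, (spinAd g (e l)) i * (spinAd g (e l)) j = if i = j then 1 else 0 := by
  have h : ∀ l i, (spinAd g (e l)) i = (spinAd g⁻¹ (e i : E n)) l := by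
    intro l i
    rw [← inner_e_left, ← inner_e_left, ← inner_spinAd g⁻¹, spinAd_inv_apply, real_inner_comm]
  simp only [h]
  have := inner_spinAd g⁻¹ (e i) (e j : E n)
  rw [PiLp.inner_apply, inner_e_left] at this
  simp only [RCLike.inner_apply, conj_trivial] at this
  rw [Finset.sum_congr rfl fun l _ => mul_comm _ _, this]
  simp [e]

/-- The spinor part drops out by unitarity. Because `ip` sums over all index tuples and not only
increasing ones, the sum over `I` of products of rotation entries factors slot by slot, and each
factor is a Kronecker delta by `sum_spinAd`. -/
theorem ip_act {n k : ℕ} (g : Spin n) (η ζ : F n k) : ip (act g η) (act g ζ) = ip η ζ := by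
  have hip : ∀ η ζ : F n k, ip η ζ =
      ∑ I : Fin k → Fin n, inner ℂ (η fun a => e (I a)) (ζ fun a => e (I a)) :=
    fun η ζ => PiLp.inner_apply _ _
  simp only [hip, act_apply, inner_spinorRep_spinorRep]
  have key : ∀ I : Fin k → Fin n,
      inner ℂ (η fun a => spinAd g⁻¹ (e (I a))) (ζ fun a => spinAd g⁻¹ (e (I a))) =
      ∑ J : Fin k → Fin n, ∑ K : Fin k → Fin n,
        ((∏ a, (spinAd g⁻¹ (e (I a)) (J a) * spinAd g⁻¹ (e (I a)) (K a)) : ℝ) : ℂ) *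
          inner ℂ (η fun a => e (J a)) (ζ fun a => e (K a)) := by
    intro I
    rw [form_expand η, form_expand ζ, sum_inner]
    refine Finset.sum_congr rfl fun J _ => ?_
    rw [inner_sum]
    refine Finset.sum_congr rfl fun K _ => ?_
    rw [← Complex.coe_smul, ← Complex.coe_smul, inner_smul_left, inner_smul_right,
      Complex.conj_ofReal, ← mul_assoc, ← Complex.ofReal_mul, Finset.prod_mul_distrib]
  rw [Finset.sum_congr rfl fun I _ => key I, Finset.sum_comm]
  refine Finset.sum_congr rfl fun J _ => ?_
  rw [Finset.sum_comm, Finset.sum_eq_single J]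
  · rw [← Finset.sum_mul, ← Complex.ofReal_sum,
      ← Fintype.prod_sum (fun a l => spinAd g⁻¹ (e l) (J a) * spinAd g⁻¹ (e l) (J a))]
    simp [sum_spinAd]
  · intro K _ hK
    rw [← Finset.sum_mul, ← Complex.ofReal_sum,
      ← Fintype.prod_sum (fun a l => spinAd g⁻¹ (e l) (J a) * spinAd g⁻¹ (e l) (K a))]
    obtain ⟨a, ha⟩ := Function.ne_iff.1 hK
    rw [Finset.prod_eq_zero (Finset.mem_univ a)]
    · simp
    · rw [sum_spinAd, if_neg ha.symm]
  · simp

/-- The orthogonal complement for the invariant Hermitian product. -/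
def orth {n k : ℕ} (W : Submodule ℂ (F n k)) : Submodule ℂ (F n k) where
  carrier := {η | ∀ w ∈ W, ip w η = 0}
  add_mem' := by
    intro a b ha hb w hw
    rw [ip, map_add, inner_add_right]
    exact (congrArg₂ (· + ·) (ha w hw) (hb w hw)).trans (add_zero 0)
  zero_mem' := by simp [ip]
  smul_mem' := by
    intro c a ha w hw
    rw [ip, map_smul, inner_smul_right]
    exact (congrArg (c * ·) (ha w hw)).trans (mul_zero c)

theorem isCompl_orth {n k : ℕ} (W : Submodule ℂ (F n k)) : IsCompl W (orth W) := by
  constructor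
  · rw [Submodule.disjoint_def]
    intro η h1 h2
    exact coords_injective ((inner_self_eq_zero.1 (h2 η h1)).trans (map_zero _).symm)
  · rw [codisjoint_iff, eq_top_iff]
    intro η _
    -- Orthogonal projection is available in the target of `coords`; the projected vector lies in
    -- the image of `W` and is pulled back.
    let V := W.map coords
    obtain ⟨w, hw, h⟩ := V.starProjection_apply_mem (coords η)
    refine Submodule.mem_sup.2 ⟨w, hw, η - w, fun u hu => ?_, by abel⟩
    rw [ip, map_sub, h]
    exact Submodule.sub_starProjection_mem_orthogonal (coords η) _ (Submodule.mem_map_of_mem hu)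

theorem ip_symm_zero {n k : ℕ} {η ζ : F n k} (h : ip η ζ = 0) : ip ζ η = 0 :=
  inner_eq_zero_symm.1 h

theorem orth_invariant {n k : ℕ} {W : Submodule ℂ (F n k)} (hW : IsInvariant W) :
    IsInvariant (orth W) := by
  intro g η hη w hw
  rw [← act_act_inv g w, ip_act]
  exact hη _ (hW _ _ hw)

/-! ## Complete reducibility -/

/-- A linear map that commutes with the action of `Spin(n)`. -/
def IsEquivariant {n k : ℕ} (p : F n k →ₗ[ℂ] F n k) : Prop :=
  ∀ (g : Spin n) (η : F n k), p (act g η) = act g (p η)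

theorem isInvariant_sSup {n k : ℕ} {C : Set (Submodule ℂ (F n k))}
    (hC : ∀ W ∈ C, IsInvariant W) : IsInvariant (sSup C) := by
  intro g
  change sSup C ≤ (sSup C).comap (actₗ g)
  refine sSup_le fun W hW η hη => ?_
  exact le_sSup hW (hC W hW g η hη)

theorem isInvariant_inf {n k : ℕ} {V W : Submodule ℂ (F n k)} (hV : IsInvariant V)
    (hW : IsInvariant W) : IsInvariant (V ⊓ W) :=
  fun g η hη => ⟨hV g η hη.1, hW g η hη.2⟩

theorem IsEquivariant.isInvariant_ker {n k : ℕ} {p : F n k →ₗ[ℂ] F n k} (hp : IsEquivariant p) :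
    IsInvariant (LinearMap.ker p) := by
  intro g η hη
  rw [LinearMap.mem_ker] at hη ⊢
  rw [hp, hη]
  exact map_zero (actₗ g)

theorem IsEquivariant.isInvariant_map {n k : ℕ} {p : F n k →ₗ[ℂ] F n k} (hp : IsEquivariant p)
    {W : Submodule ℂ (F n k)} (hW : IsInvariant W) : IsInvariant (W.map p) := by
  rintro g _ ⟨η, hη, rfl⟩
  exact ⟨act g η, hW g η hη, hp g η⟩

theorem isEquivariant_projection {n k : ℕ} {V W : Submodule ℂ (F n k)} (h : IsCompl V W)
    (hV : IsInvariant V) (hW : IsInvariant W) : IsEquivariant (V.projection W h) := by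
  intro g η
  obtain ⟨a, ha, b, hb, rfl⟩ := Submodule.mem_sup.1 (h.sup_eq_top ▸ Submodule.mem_top (x := η))
  rw [act_add, map_add, map_add, Submodule.projection_apply_of_mem_left h ha,
    Submodule.projection_apply_of_mem_left h (hV g a ha),
    (Submodule.projection_apply_eq_zero_iff h).2 hb,
    (Submodule.projection_apply_eq_zero_iff h).2 (hW g b hb), add_zero, add_zero]

theorem IsEquivariant.isWeightVector {n k : ℕ} {p : F n k →ₗ[ℂ] F n k} (hp : IsEquivariant p)
    {μ : Fin (n / 2) → ℝ} {η : F n k} (hη : IsWeightVector μ η) (h : p η ≠ 0) :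
    IsWeightVector μ (p η) :=
  ⟨h, fun m θ => by rw [← hp, hη.2 m θ, map_smul]⟩

theorem exists_irreducible_le {n k : ℕ} {W : Submodule ℂ (F n k)} (hW : IsInvariant W)
    (h : W ≠ ⊥) : ∃ V ≤ W, IsIrreducible V := by
  obtain ⟨V, ⟨hVW, hV, hV0⟩, hmin⟩ :=
    wellFounded_lt.has_min {V : Submodule ℂ (F n k) | V ≤ W ∧ IsInvariant V ∧ V ≠ ⊥}
      ⟨W, le_rfl, hW, h⟩
  refine ⟨V, hVW, hV, hV0, fun V' hV' hinv => ?_⟩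
  by_contra! hc
  exact hmin V' ⟨hV'.trans hVW, hinv, hc.1⟩ (lt_of_le_of_ne hV' hc.2)

/-- The orthogonal complement of the sum is invariant. Were it nonzero, it would contain an
irreducible subspace, which already lies in the sum. -/
theorem sSup_irreducible {n k : ℕ} : sSup {W : Submodule ℂ (F n k) | IsIrreducible W} = ⊤ := by
  set V := sSup {W : Submodule ℂ (F n k) | IsIrreducible W} with hV
  by_contra hne
  have hinv : IsInvariant V := isInvariant_sSup fun W hW => hW.1
  have h0 : orth V ≠ ⊥ := fun h => hne (by simpa [h] using (isCompl_orth V).sup_eq_top)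
  obtain ⟨W, hW, hirr⟩ := exists_irreducible_le (orth_invariant hinv) h0
  exact hirr.2.1 (((isCompl_orth V).disjoint.symm.mono_left hW).eq_bot_of_le (le_sSup hirr))

/-- Irreducible subrepresentations linked by a nonzero equivariant map have the same weights. -/
theorem weights_iff_of_equivariant {n k : ℕ} {V W : Submodule ℂ (F n k)} (hV : IsIrreducible V)
    (hW : IsIrreducible W) {p : F n k →ₗ[ℂ] F n k} (hp : IsEquivariant p)
    (hVW : V.map p ≤ W) (hne : V.map p ≠ ⊥) (ν : Fin (n / 2) → ℝ) :
    (∃ η ∈ V, IsWeightVector ν η) ↔ ∃ η ∈ W, IsWeightVector ν η := by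
  have hmap : V.map p = W := (hW.2.2 _ hVW (hp.isInvariant_map hV.1)).resolve_left hne
  have hker : V ⊓ LinearMap.ker p = ⊥ := by
    refine (hV.2.2 _ inf_le_left (isInvariant_inf hV.1 hp.isInvariant_ker)).resolve_right ?_
    intro h
    apply hne
    rw [eq_bot_iff, Submodule.map_le_iff_le_comap]
    exact h ▸ inf_le_right
  have hinj : ∀ η ∈ V, p η = 0 → η = 0 := fun η hη h0 => by
    have : η ∈ V ⊓ LinearMap.ker p := ⟨hη, h0⟩
    rwa [hker, Submodule.mem_bot] at this
  constructor
  · rintro ⟨η, hη, hw⟩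
    exact ⟨p η, hmap ▸ Submodule.mem_map_of_mem hη,
      hp.isWeightVector hw fun h0 => hw.1 (hinj η hη h0)⟩
  · rintro ⟨ζ, hζ, hw⟩
    rw [← hmap] at hζ
    obtain ⟨η, hη, rfl⟩ := hζ
    refine ⟨η, hη, fun h0 => hw.1 (by rw [h0, map_zero]), fun m θ => ?_⟩
    -- The defect of the weight equation for `η` lies in `V` and is killed by `p`, which is
    -- injective on `V`.
    refine sub_eq_zero.1 (hinj _ (V.sub_mem (hV.1 _ _ hη) (V.smul_mem _ hη)) ?_)
    rw [map_sub, hp, map_smul, hw.2 m θ, sub_self]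

theorem hasType_iff_of_equivariant {n k : ℕ} {V W : Submodule ℂ (F n k)} (hV : IsIrreducible V)
    (hW : IsIrreducible W) {p : F n k →ₗ[ℂ] F n k} (hp : IsEquivariant p)
    (hVW : V.map p ≤ W) (hne : V.map p ≠ ⊥) (j : ℕ) : HasType j V ↔ HasType j W := by
  simp only [HasType, HasHighestWeight, weights_iff_of_equivariant hV hW hp hVW hne]

theorem isInvariant_comp (n k j : ℕ) : IsInvariant (comp n k j) :=
  isInvariant_sSup fun _ hW => hW.1.1

theorem isInvariant_coComp (n k j : ℕ) : IsInvariant (coComp n k j) :=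
  isInvariant_sSup fun _ hW => hW.1.1

theorem orth_antitone {n k : ℕ} {V W : Submodule ℂ (F n k)} (h : V ≤ orth W) : W ≤ orth V :=
  fun w hw _ hv => ip_symm_zero (h hv w hw)

/-- Schur's lemma: the orthogonal projection onto `W` is equivariant, and if it were nonzero on `V`
the two irreducibles would have the same weights, hence the same type. -/
theorem le_orth_of_hasType {n k j : ℕ} {V W : Submodule ℂ (F n k)} (hV : IsIrreducible V)
    (hVj : HasType j V) (hW : IsIrreducible W) (hWj : ¬ HasType j W) : V ≤ orth W := by
  have hc := isCompl_orth W
  have hp := isEquivariant_projection hc hW.1 (orth_invariant hW.1)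
  by_contra hne
  refine hWj ((hasType_iff_of_equivariant hV hW hp ?_ ?_ j).1 hVj)
  · rintro _ ⟨η, -, rfl⟩
    exact Submodule.projection_apply_mem hc η
  · intro h
    refine hne fun η hη => (Submodule.projection_apply_eq_zero_iff hc).1 ?_
    rw [← Submodule.mem_bot (R := ℂ), ← h]
    exact Submodule.mem_map_of_mem hη

/-- `E^{k,j}` and the sum of the other irreducible components are complementary. -/
theorem isCompl_comp_coComp (n k j : ℕ) : IsCompl (comp n k j) (coComp n k j) := by
  constructor
  · have : comp n k j ≤ orth (coComp n k j) := by
      refine sSup_le fun _ hV => orth_antitone (sSup_le fun _ hW => orth_antitone ?_)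
      exact le_orth_of_hasType hV.1 hV.2 hW.1 hW.2
    exact (isCompl_orth (coComp n k j)).disjoint.symm.mono_left this
  · rw [codisjoint_iff, eq_top_iff, ← sSup_irreducible]
    refine sSup_le fun W hW => ?_
    by_cases h : HasType j W
    · exact (le_sSup (show W ∈ {W | IsIrreducible W ∧ HasType j W} from ⟨hW, h⟩)).trans le_sup_left
    · exact (le_sSup (show W ∈ {W | IsIrreducible W ∧ ¬ HasType j W} from ⟨hW, h⟩)).trans
        le_sup_right

/-! ### Weight vectors in the component `E^{k,j}` -/

theorem proj_eq_self {n k j : ℕ} {η : F n k} (h : η ∈ comp n k j) : proj n k j η = η := by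
  rw [proj, dif_pos (isCompl_comp_coComp n k j)]
  exact Submodule.projection_apply_of_mem_left _ h

/-- A weight vector for `λ_j` lies in `E^{k,j}` if `λ_j` is the highest of all weights. -/
theorem mem_comp_of_isWeightVector {n k j : ℕ}
    (hmax : ∀ (ν : Fin (n / 2) → ℝ) (ζ : F n k), IsWeightVector ν ζ → toLex ν ≤ toLex (wt n j))
    {η : F n k} (hη : IsWeightVector (wt n j) η) : η ∈ comp n k j := by
  have hc := (isCompl_comp_coComp n k j).symm
  have hp := isEquivariant_projection hc (isInvariant_coComp n k j) (isInvariant_comp n k j)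
  rw [← Submodule.projection_apply_eq_zero_iff hc]
  by_contra h0
  have hw := hp.isWeightVector hη h0
  have hmem := Submodule.projection_apply_mem hc η
  set ζ := (coComp n k j).projection (comp n k j) hc η
  -- A nonzero projection of `ζ` to a summand `W` of `coComp` would be a vector of weight `λ_j` in
  -- `W`, and by maximality `W` would have type `j`. So `ζ` is orthogonal to all of `coComp`, which
  -- contains it, and must vanish.
  have key : coComp n k j ≤ orth (Submodule.span ℂ {ζ}) := by
    refine sSup_le fun W hW => orth_antitone ?_
    rw [Submodule.span_singleton_le_iff_mem]
    have hcW := isCompl_orth W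
    have hpW := isEquivariant_projection hcW hW.1.1 (orth_invariant hW.1.1)
    rw [← Submodule.projection_apply_eq_zero_iff hcW]
    by_contra h1
    exact hW.2 (Or.inl ⟨⟨_, Submodule.projection_apply_mem hcW ζ, hpW.isWeightVector hw h1⟩,
      fun ν ⟨ξ, _, hξ⟩ => hmax ν ξ hξ⟩)
  have : ζ ∈ (⊥ : Submodule ℂ (F n k)) :=
    (isCompl_orth (Submodule.span ℂ {ζ})).disjoint.le_bot
      ⟨Submodule.mem_span_singleton_self ζ, key hmem⟩
  exact h0 ((Submodule.mem_bot ℂ).1 this)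

/-! ## The action of the maximal torus -/

theorem ι_e_mul_self {n : ℕ} (i : Fin n) :
    CliffordAlgebra.ι (Q n) (e i) * CliffordAlgebra.ι (Q n) (e i) = -1 := by
  rw [CliffordAlgebra.ι_sq_scalar, Q_apply]
  simp [e]

theorem ι_e_anticomm {n : ℕ} {i j : Fin n} (h : i ≠ j) :
    CliffordAlgebra.ι (Q n) (e i) * CliffordAlgebra.ι (Q n) (e j) =
      -(CliffordAlgebra.ι (Q n) (e j) * CliffordAlgebra.ι (Q n) (e i)) := by
  rw [eq_neg_iff_add_eq_zero, CliffordAlgebra.ι_mul_ι_add_swap, QuadraticMap.polar]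
  simp only [Q_apply, e, inner_add_left, inner_add_right, EuclideanSpace.inner_single_left,
    PiLp.single_apply, h, h.symm, if_false]
  simp

/-- The first coordinate index of the `m`-th plane. -/
def fstIdx {n : ℕ} (m : Fin (n / 2)) : Fin n := ⟨2 * m.val, by omega⟩

/-- The second coordinate index of the `m`-th plane. -/
def sndIdx {n : ℕ} (m : Fin (n / 2)) : Fin n := ⟨2 * m.val + 1, by omega⟩

theorem fstIdx_ne_sndIdx {n : ℕ} (m : Fin (n / 2)) : fstIdx m ≠ sndIdx m := by
  simp [fstIdx, sndIdx]

theorem coe_torus {n : ℕ} (m : Fin (n / 2)) (θ : ℝ) :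
    (torus m θ : CliffordAlgebra (Q n)) =
      Real.cos (θ / 2) • 1 + Real.sin (θ / 2) •
      (CliffordAlgebra.ι (Q n) (e (fstIdx m)) * CliffordAlgebra.ι (Q n) (e (sndIdx m))) := by
  rw [← Algebra.algebraMap_eq_smul_one]; rfl

theorem torus_inv {n : ℕ} (m : Fin (n / 2)) (θ : ℝ) : (torus m θ)⁻¹ = torus m (-θ) := by
  apply Subtype.ext
  rw [coe_inv_spin, coe_torus, coe_torus, star_add, CliffordAlgebra.star_smul,
    CliffordAlgebra.star_smul, star_mul, star_one, CliffordAlgebra.star_ι, CliffordAlgebra.star_ι,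
    neg_mul_neg, ι_e_anticomm (fstIdx_ne_sndIdx m).symm, neg_div, Real.cos_neg, Real.sin_neg,
    neg_smul, smul_neg]

theorem cos_eq_half (θ : ℝ) : Real.cos θ = Real.cos (θ / 2) ^ 2 - Real.sin (θ / 2) ^ 2 := by
  rw [← Real.cos_two_mul']; congr 1; ring

theorem sin_eq_half (θ : ℝ) : Real.sin θ = 2 * Real.sin (θ / 2) * Real.cos (θ / 2) := by
  rw [← Real.sin_two_mul]; congr 1; ring

/-- The torus element is written in half angles; commuting it past a basis vector yields the
double-angle formulas. -/
theorem spinAd_torus_fst {n : ℕ} (m : Fin (n / 2)) (θ : ℝ) :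
    spinAd (torus m θ) (e (fstIdx m)) =
      Real.cos θ • e (fstIdx m) + Real.sin θ • (e (sndIdx m) : E n) := by
  apply spinAd_eq_of
  rw [coe_torus, map_add, map_smul, map_smul]
  set a := CliffordAlgebra.ι (Q n) (e (fstIdx m))
  set b := CliffordAlgebra.ι (Q n) (e (sndIdx m))
  have ha : a * a = -1 := ι_e_mul_self _
  have hb : b * b = -1 := ι_e_mul_self _
  have hab : b * a = -(a * b) := ι_e_anticomm (fstIdx_ne_sndIdx m).symm
  have h1 : a * b * a = b := by rw [mul_assoc, hab, mul_neg, ← mul_assoc, ha]; simp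
  have h2 : a * (a * b) = -b := by rw [← mul_assoc, ha]; simp
  have h3 : b * (a * b) = a := by rw [← mul_assoc, hab, neg_mul, mul_assoc, hb]; simp
  simp only [add_mul, mul_add, smul_mul_assoc, mul_smul_comm, one_mul, mul_one, h1, h2, h3,
    smul_neg]
  rw [cos_eq_half θ, sin_eq_half θ]
  have hcs := Real.sin_sq_add_cos_sq (θ / 2)
  set c := Real.cos (θ / 2)
  set s := Real.sin (θ / 2)
  match_scalars
  · linear_combination (-c) * hcs
  · linear_combination (-s) * hcs

theorem spinAd_torus_snd {n : ℕ} (m : Fin (n / 2)) (θ : ℝ) :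
    spinAd (torus m θ) (e (sndIdx m)) =
      Real.cos θ • e (sndIdx m) - Real.sin θ • (e (fstIdx m) : E n) := by
  apply spinAd_eq_of
  rw [coe_torus, map_sub, map_smul, map_smul]
  set a := CliffordAlgebra.ι (Q n) (e (fstIdx m))
  set b := CliffordAlgebra.ι (Q n) (e (sndIdx m))
  have ha : a * a = -1 := ι_e_mul_self _
  have hb : b * b = -1 := ι_e_mul_self _
  have hab : b * a = -(a * b) := ι_e_anticomm (fstIdx_ne_sndIdx m).symm
  have h1 : a * b * b = -a := by rw [mul_assoc, hb]; simp
  have h2 : a * (a * b) = -b := by rw [← mul_assoc, ha]; simp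
  have h3 : b * (a * b) = a := by rw [← mul_assoc, hab, neg_mul, mul_assoc, hb]; simp
  simp only [add_mul, sub_mul, mul_add, smul_mul_assoc, mul_smul_comm, one_mul, mul_one, h1, h2, h3,
    smul_neg]
  rw [cos_eq_half θ, sin_eq_half θ]
  have hcs := Real.sin_sq_add_cos_sq (θ / 2)
  set c := Real.cos (θ / 2)
  set s := Real.sin (θ / 2)
  match_scalars
  · linear_combination (-c) * hcs
  · linear_combination s * hcs

theorem spinAd_torus_of_ne {n : ℕ} (m : Fin (n / 2)) (θ : ℝ) {i : Fin n} (h1 : i ≠ fstIdx m)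
    (h2 : i ≠ sndIdx m) : spinAd (torus m θ) (e i) = e i := by
  apply spinAd_eq_of
  rw [coe_torus, add_mul, mul_add, smul_mul_assoc, smul_mul_assoc, mul_smul_comm, mul_smul_comm,
    one_mul, mul_one]
  congr 2
  rw [mul_assoc, ι_e_anticomm h2.symm, mul_neg, ← mul_assoc, ι_e_anticomm h1.symm, neg_mul, neg_neg,
    mul_assoc]

/-- Both generators of the `m`-th plane flip the entry `m`, so their product is diagonal, with
eigenvalue `i` on an empty and `-i` on an occupied place. The basis spinors are therefore weight
vectors. -/
theorem spinorRep_torus {n : ℕ} (m : Fin (n / 2)) (θ : ℝ) (s : S n) (b : Fin (n / 2) → Bool) :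
    spinorRep n (torus m θ) s b =
      Complex.exp ((((if b m = true then -1 / 2 else 1 / 2) * θ : ℝ) : ℂ) * Complex.I) * s b := by
  have h1 : (fstIdx m).val / 2 < n / 2 := by simp only [fstIdx]; omega
  have h2 : (sndIdx m).val / 2 < n / 2 := by simp only [sndIdx]; omega
  have e1 : (⟨(fstIdx m).val / 2, h1⟩ : Fin (n / 2)) = m := Fin.ext (by simp [fstIdx])
  have e2 : (⟨(sndIdx m).val / 2, h2⟩ : Fin (n / 2)) = m :=
    Fin.ext (by simp only [sndIdx]; omega)
  have hc : ∀ i, cliff n (e i) = gen n i := by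
    intro i
    simp only [cliff, LinearMap.coe_mk, AddHom.coe_mk, e]
    rw [Finset.sum_eq_single i]
    · simp
    · intro j _ hj
      ext; simp [hj]
    · simp
  rw [coe_torus, map_add, map_smul, map_smul, map_one, map_mul, spinorRep,
    CliffordAlgebra.lift_ι_apply, CliffordAlgebra.lift_ι_apply, hc, hc]
  change (Real.cos (θ / 2) : ℝ) • s b + (Real.sin (θ / 2) : ℝ) •
    (gen n (fstIdx m) (gen n (sndIdx m) s)) b = _
  rw [gen_apply, dif_pos h1, gen_apply, dif_pos h2, e1, e2, flipAt_flipAt, ← mul_assoc]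
  have hcoef : genCoeff (fstIdx m).val m b * genCoeff (sndIdx m).val m (flipAt m b) =
      (if b m = true then -1 else 1) * Complex.I := by
    have hj := jwSign_mul_self m.val b
    have h2 : flipAt m b m = !b m := by simp [flipAt]
    simp only [genCoeff, jwSign_flip, lt_irrefl, if_false, h2, fstIdx, sndIdx]
    cases hb : b m <;> simp [Nat.add_mod] <;> linear_combination Complex.I * hj
  rw [hcoef, Complex.exp_mul_I, ← Complex.ofReal_cos, ← Complex.ofReal_sin]
  cases hb : b m
  · simp only [Bool.false_eq_true, if_false, Complex.real_smul]
    rw [show (1 / 2 : ℝ) * θ = θ / 2 by ring]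
    ring
  · simp only [if_true, Complex.real_smul]
    rw [show (-1 / 2 : ℝ) * θ = -(θ / 2) by ring, Real.cos_neg, Real.sin_neg]
    push_cast
    ring

/-! ## The weights of `Λʲ(ℂⁿ) ⊗ S` -/

/-- The weight of the basis spinor `b` in the place `m`. -/
def spinWt {k : ℕ} (b : Fin k → Bool) (m : Fin k) : ℝ := if b m = true then -1 / 2 else 1 / 2

theorem spinWt_le {k : ℕ} (b : Fin k → Bool) (m : Fin k) : spinWt b m ≤ 1 / 2 := by
  rw [spinWt]; split_ifs <;> norm_num

/-- Taking the component `b` splits off the spinor weight: what remains is a scalar form of weight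
`ν - spinWt b`, on which the torus acts through the arguments alone. -/
theorem IsWeightVector.apply_spinAd_torus {n k : ℕ} {ν : Fin (n / 2) → ℝ} {η : F n k}
    (h : IsWeightVector ν η) (m : Fin (n / 2)) (θ : ℝ) (x : Fin k → E n)
    (b : Fin (n / 2) → Bool) :
    η (fun a => spinAd (torus m θ) (x a)) b =
      Complex.exp (-((((ν m - spinWt b m) * θ : ℝ) : ℂ) * Complex.I)) * η x b := by
  -- The angle `-θ` cancels the inverse that `act` puts on the arguments.
  have h1 := congrArg (fun ζ : F n k => ζ x b) (h.2 m (-θ))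
  change act (torus m (-θ)) η x b =
    Complex.exp (((ν m * -θ : ℝ) : ℂ) * Complex.I) * η x b at h1
  rw [act_apply, spinorRep_torus, torus_inv, neg_neg] at h1
  change Complex.exp (((spinWt b m * -θ : ℝ) : ℂ) * Complex.I) * _ = _ at h1
  rw [← mul_right_inj' (Complex.exp_ne_zero (((spinWt b m * -θ : ℝ) : ℂ) * Complex.I)), h1,
    ← mul_assoc, ← Complex.exp_add]
  congr 2
  push_cast
  ring

theorem eq_zero_of_cos_mul_eq_one {κ : ℝ} (h : ∀ θ, Real.cos (κ * θ) = 1) : κ = 0 := by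
  by_contra h0
  have := h (Real.pi / κ)
  rw [mul_div_cancel₀ _ h0, Real.cos_pi] at this
  norm_num at this

theorem abs_le_one_of_cos_mul_eq_cos {κ : ℝ} (h : ∀ θ, Real.cos (κ * θ) = Real.cos θ) :
    |κ| ≤ 1 := by
  by_contra! h1
  have hκ : 0 < |κ| := by linarith
  -- At `θ = π / |κ|` the left side is `-1`; if `|κ| > 1` this angle is strictly between `0` and
  -- `π`, where the cosine exceeds `-1`.
  have h0 : Real.cos (Real.pi / |κ|) = -1 := by
    rw [← h, ← Real.cos_abs, abs_mul, abs_div, abs_abs, abs_of_pos Real.pi_pos,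
      mul_div_cancel₀ _ hκ.ne', Real.cos_pi]
  have hlt : Real.pi / |κ| < Real.pi := div_lt_self Real.pi_pos h1
  have := Real.cos_lt_cos_of_nonneg_of_le_pi (div_pos Real.pi_pos hκ).le le_rfl hlt
  rw [Real.cos_pi, h0] at this
  exact lt_irrefl _ this

/-- Adding the values at `θ` and `-θ` cancels the sine term, whose coefficient is an unknown value
of the form on another tuple. -/
theorem cos_mul_eq_of_rotation {c : ℂ} (hc : c ≠ 0) {κ : ℝ} (f : ℝ → ℂ) (C : ℝ → ℝ)
    (hf : ∀ θ, f θ = Complex.exp (-(((κ * θ : ℝ) : ℂ) * Complex.I)) * c)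
    (hC : ∀ θ, f θ + f (-θ) = 2 * (C θ : ℂ) * c) (θ : ℝ) : Real.cos (κ * θ) = C θ := by
  have h := hC θ
  rw [hf, hf, ← add_mul] at h
  have h2 := mul_right_cancel₀ hc h
  have h3 : Complex.exp (-(((κ * θ : ℝ) : ℂ) * Complex.I)) +
      Complex.exp (-(((κ * -θ : ℝ) : ℂ) * Complex.I)) = 2 * (Real.cos (κ * θ) : ℂ) := by
    rw [Complex.ofReal_cos, Complex.cos]
    push_cast
    rw [show -(↑κ * -↑θ * Complex.I) = (κ : ℂ) * θ * Complex.I by ring, neg_mul]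
    ring
  rw [h3] at h2
  exact_mod_cast mul_left_cancel₀ two_ne_zero h2

/-- As the form alternates, `I` is injective and meets the `m`-th plane in zero, one or two indices.
With zero or two the value is invariant under the rotation, so `κ = 0`; with one, symmetrizing gives
`cos (κ θ) = cos θ`, so `|κ| ≤ 1`. -/
theorem plane_weight {n k : ℕ} (η : F n k) (b : Fin (n / 2) → Bool) (m : Fin (n / 2))
    (I : Fin k → Fin n) (hI : η (fun a => e (I a)) b ≠ 0) {κ : ℝ}
    (hκ : ∀ θ, η (fun a => spinAd (torus m θ) (e (I a))) b =
      Complex.exp (-(((κ * θ : ℝ) : ℂ) * Complex.I)) * η (fun a => e (I a)) b) :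
    |κ| ≤ 1 ∧ ((∀ a, I a ≠ fstIdx m ∧ I a ≠ sndIdx m) → κ = 0) := by
  have hinj : Function.Injective I := by
    intro a a' haa
    by_contra hne
    apply hI
    rw [η.map_eq_zero_of_eq _ (congrArg e haa) hne]
    rfl
  set x : Fin k → E n := fun a => e (I a) with hx
  have hrot := fun C => cos_mul_eq_of_rotation hI _ C hκ
  have hfix : ∀ θ a, I a ≠ fstIdx m → I a ≠ sndIdx m → spinAd (torus m θ) (e (I a)) = x a :=
    fun θ a h1 h2 => spinAd_torus_of_ne m θ h1 h2
  by_cases h1 : ∃ a, I a = fstIdx m <;> by_cases h2 : ∃ a, I a = sndIdx m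
  · obtain ⟨a, ha⟩ := h1
    obtain ⟨a', ha'⟩ := h2
    have hne : a ≠ a' := fun h => fstIdx_ne_sndIdx m (by rw [← ha, ← ha', h])
    -- Both directions of the plane occur among the arguments, so the value is multiplied by the
    -- determinant of the rotation, `cos² + sin² = 1`.
    have hR : ∀ θ, η (fun a => spinAd (torus m θ) (e (I a))) b = η x b := by
      intro θ
      have hupd : (fun a => spinAd (torus m θ) (e (I a))) =
          Function.update (Function.update x a (Real.cos θ • x a + Real.sin θ • x a')) a'
            (Real.cos θ • x a' - Real.sin θ • x a) := by
        funext c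
        by_cases hc' : c = a'
        · subst hc'
          simp only [Function.update_self, hx, ha, ha', spinAd_torus_snd]
        · by_cases hc : c = a
          · subst hc
            simp only [Function.update_self, Function.update_of_ne hc', hx, ha, ha',
              spinAd_torus_fst]
          · rw [Function.update_of_ne hc', Function.update_of_ne hc]
            exact hfix θ c (fun h => hc (hinj (h.trans ha.symm)))
              (fun h => hc' (hinj (h.trans ha'.symm)))
      have hz : ∀ y : E n, η (Function.update (Function.update x a y) a' y) = 0 := fun y =>
        η.map_eq_zero_of_eq _ (by
          rw [Function.update_self, Function.update_of_ne hne, Function.update_self]) hne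
      have hid : Function.update (Function.update x a (x a)) a' (x a') = x := by simp
      have hsw : η (Function.update (Function.update x a (x a')) a' (x a)) = -η x := by
        refine Eq.trans ?_ (η.toAlternatingMap.map_swap x hne)
        change η _ = η _
        congr 1
        funext c
        by_cases hc' : c = a'
        · subst hc'; simp
        · by_cases hc : c = a
          · subst hc; simp [hc']
          · simp [hc, hc', Equiv.swap_apply_of_ne_of_ne hc hc']
      rw [hupd, η.map_update_sub, η.map_update_smul, η.map_update_smul,
        Function.update_comm hne, Function.update_comm hne, η.map_update_add, η.map_update_add,
        η.map_update_smul, η.map_update_smul, η.map_update_smul, η.map_update_smul,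
        ← Function.update_comm hne, ← Function.update_comm hne, ← Function.update_comm hne,
        ← Function.update_comm hne, hz, hz, hid, hsw, smul_zero, smul_zero, add_zero, zero_add,
        smul_neg, smul_neg, sub_neg_eq_add, smul_smul, smul_smul, ← add_smul, ← sq, ← sq,
        add_comm, Real.sin_sq_add_cos_sq, one_smul]
    have h0 : κ = 0 := eq_zero_of_cos_mul_eq_one (hrot (fun _ => 1) fun θ => by
      rw [hR, hR]; push_cast; ring)
    exact ⟨by simp [h0], fun _ => h0⟩
  · obtain ⟨a, ha⟩ := h1
    push Not at h2
    refine ⟨abs_le_one_of_cos_mul_eq_cos (hrot Real.cos fun θ => ?_), fun h => absurd ha (h a).1⟩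
    have hR : ∀ θ, η (fun a => spinAd (torus m θ) (e (I a))) =
        Real.cos θ • η x + Real.sin θ • η (Function.update x a (e (sndIdx m))) := by
      intro θ
      have hupd : (fun a => spinAd (torus m θ) (e (I a))) =
          Function.update x a (Real.cos θ • x a + Real.sin θ • e (sndIdx m)) := by
        funext c
        by_cases hc : c = a
        · subst hc
          simp only [Function.update_self, hx, ha, spinAd_torus_fst]
        · rw [Function.update_of_ne hc]
          exact hfix θ c (fun h => hc (hinj (h.trans ha.symm))) (h2 c)
      rw [hupd, η.map_update_add, η.map_update_smul, η.map_update_smul, Function.update_eq_self]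
    rw [hR, hR, Real.cos_neg, Real.sin_neg]
    simp only [PiLp.add_apply, PiLp.smul_apply, Complex.real_smul]
    push_cast
    ring
  · obtain ⟨a, ha⟩ := h2
    push Not at h1
    refine ⟨abs_le_one_of_cos_mul_eq_cos (hrot Real.cos fun θ => ?_), fun h => absurd ha (h a).2⟩
    have hR : ∀ θ, η (fun a => spinAd (torus m θ) (e (I a))) =
        Real.cos θ • η x - Real.sin θ • η (Function.update x a (e (fstIdx m))) := by
      intro θ
      have hupd : (fun a => spinAd (torus m θ) (e (I a))) =
          Function.update x a (Real.cos θ • x a - Real.sin θ • e (fstIdx m)) := by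
        funext c
        by_cases hc : c = a
        · subst hc
          simp only [Function.update_self, hx, ha, spinAd_torus_snd]
        · rw [Function.update_of_ne hc]
          exact hfix θ c (h1 c) (fun h => hc (hinj (h.trans ha.symm)))
      rw [hupd, η.map_update_sub, η.map_update_smul, η.map_update_smul, Function.update_eq_self]
    rw [hR, hR, Real.cos_neg, Real.sin_neg]
    simp only [PiLp.sub_apply, PiLp.smul_apply, Complex.real_smul]
    push_cast
    ring
  · push Not at h1 h2
    have hR : ∀ θ, (fun a => spinAd (torus m θ) (e (I a))) = x := fun θ =>
      funext fun a => hfix θ a (h1 a) (h2 a)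
    have h0 : κ = 0 := eq_zero_of_cos_mul_eq_one (hrot (fun _ => 1) fun θ => by
      rw [hR, hR]; push_cast; ring)
    exact ⟨by simp [h0], fun _ => h0⟩

/-- `λ_j` is the lexicographically highest weight of `Λʲ(ℂⁿ) ⊗ S`. -/
theorem IsWeightVector.toLex_le {n j : ℕ} {ν : Fin (n / 2) → ℝ} {η : F n j}
    (h : IsWeightVector ν η) : toLex ν ≤ toLex (wt n j) := by
  obtain ⟨I, b, hI⟩ : ∃ (I : Fin j → Fin n) (b : Fin (n / 2) → Bool),
      η (fun a => e (I a)) b ≠ 0 := by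
    by_contra! hc
    refine h.1 (coords_injective (PiLp.ext fun I => PiLp.ext fun b => ?_))
    rw [coords_apply, hc, map_zero]
    rfl
  have hpl := fun m => plane_weight η b m I hI fun θ => h.apply_spinAd_torus m θ _ b
  by_contra hlt
  -- `m` is the first place where the weights differ. A form part of at most `1` and a spinor part
  -- of at most `1/2` rule out exceeding `3/2`, so only `m ≥ j` needs work.
  obtain ⟨m, hm1, hm2⟩ := not_le.1 hlt
  change ∀ i < m, wt n j i = ν i at hm1
  change wt n j m < ν m at hm2
  have hle := (abs_le.1 (hpl m).1).2
  have hs := spinWt_le b m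
  by_cases hmj : m.val < j
  · rw [wt, if_pos hmj] at hm2
    linarith
  · rw [wt, if_neg hmj] at hm2
    -- The entries of `ν` before `m` agree with `λ_j`, so each of the first `j` planes has entry
    -- `3/2` and must contain an index of `I`. This uses up all `j` slots and leaves none for the
    -- plane `m`.
    have hit : ∀ i : Fin j, ∃ a, (I a).val / 2 = i.val := by
      intro i
      by_contra! hno
      have hi : i.val < n / 2 := by omega
      have h0 := (hpl ⟨i.val, hi⟩).2 fun a => by
        have := hno a
        constructor <;> intro hEq <;> apply this <;> rw [hEq] <;> simp only [fstIdx, sndIdx] <;>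
          omega
      have h1 := hm1 ⟨i.val, hi⟩ (Fin.lt_def.2 (by simp only; omega))
      rw [wt, if_pos i.isLt] at h1
      have := spinWt_le b ⟨i.val, hi⟩
      linarith
    choose a ha using hit
    have hinj : Function.Injective a := fun i i' hii =>
      Fin.ext (by rw [← ha i, ← ha i', hii])
    have h0 := (hpl m).2 fun c => by
      obtain ⟨i, rfl⟩ := (Finite.injective_iff_surjective.1 hinj) c
      have := ha i
      constructor <;> intro hEq <;> rw [hEq] at this <;> simp only [fstIdx, sndIdx] at this <;>
        omega
    linarith

/-! ## The highest weight vector -/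

theorem outerMul_apply {n k : ℕ} (v : E n →L[ℝ] ℂ) (η : F n k) (x : Fin (k + 1) → E n) :
    outerMul v η x = ∑ i : Fin (k + 1), (-1 : ℤ) ^ i.val • v (x i) • η (i.removeNth x) := by
  rw [outerMul, ContinuousAlternatingMap.alternatizeUncurryFin_apply]
  rfl

theorem act_outerMul {n k : ℕ} (g : Spin n) (v : E n →L[ℝ] ℂ) (η : F n k) :
    act g (outerMul v η) = outerMul (v ∘L spinAd g⁻¹) (act g η) := by
  refine ContinuousAlternatingMap.ext fun x => ?_
  rw [act_apply, outerMul_apply, outerMul_apply, map_sum]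
  refine Finset.sum_congr rfl fun i _ => ?_
  rw [map_zsmul, map_smul]
  rfl

theorem outerMul_smul_smul {n k : ℕ} (c d : ℂ) (v : E n →L[ℝ] ℂ) (η : F n k) :
    outerMul (c • v) (d • η) = (c * d) • outerMul v η := by
  refine ContinuousAlternatingMap.ext fun x => ?_
  rw [ContinuousAlternatingMap.smul_apply, outerMul_apply, outerMul_apply, Finset.smul_sum]
  refine Finset.sum_congr rfl fun i _ => ?_
  rw [smul_comm (c * d)]
  simp only [smul_apply, ContinuousAlternatingMap.smul_apply, smul_eq_mul, smul_smul]
  congr 2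
  ring

theorem outerMul_add_left {n k : ℕ} (v w : E n →L[ℝ] ℂ) (η : F n k) :
    outerMul (v + w) η = outerMul v η + outerMul w η := by
  refine ContinuousAlternatingMap.ext fun x => ?_
  rw [ContinuousAlternatingMap.add_apply]
  simp only [outerMul_apply, add_apply, add_smul, smul_add, Finset.sum_add_distrib]

theorem outerMul_smul_left {n k : ℕ} (c : ℂ) (v : E n →L[ℝ] ℂ) (η : F n k) :
    outerMul (c • v) η = c • outerMul v η := by
  simpa using outerMul_smul_smul c 1 v η

theorem outerMul_smul_right {n k : ℕ} (c : ℂ) (v : E n →L[ℝ] ℂ) (η : F n k) :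
    outerMul v (c • η) = c • outerMul v η := by
  simpa using outerMul_smul_smul 1 c v η

theorem outerMul_outerMul_self {n k : ℕ} (v : E n →L[ℝ] ℂ) (η : F n k) :
    outerMul v (outerMul v η) = 0 := by
  let L : E n →L[ℝ] E n →L[ℝ] F n k := LinearMap.toContinuousLinearMap
    { toFun := fun x => v x • v.smulRight η
      map_add' := fun x y => by
        rw [map_add]
        exact ContinuousLinearMap.ext fun z => add_smul (v x) (v y) (v z • η)
      map_smul' := fun c x => by rw [map_smul, smul_assoc, RingHom.id_apply] }
  -- Alternating twice annihilates the symmetric bilinear map `(x, y) ↦ v x • v y • η`; this is `v ∧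
  -- v = 0`, in the same way as `d² = 0`.
  have h := ContinuousAlternatingMap.alternatizeUncurryFin_alternatizeUncurryFinCLM_comp_of_symmetric
    (𝕜 := ℝ) (E := E n) (F := S n) (n := k) (f := L) (by
      intro x y
      change v x • v y • η = v y • v x • η
      rw [smul_comm])
  rw [← h, outerMul, outerMul]
  congr 1
  refine ContinuousLinearMap.ext fun x => ?_
  exact (ContinuousAlternatingMap.alternatizeUncurryFin_smul (v x) (v.smulRight η)).symm

theorem outerMul_add_right {n k : ℕ} (v : E n →L[ℝ] ℂ) (η ζ : F n k) :
    outerMul v (η + ζ) = outerMul v η + outerMul v ζ := by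
  refine ContinuousAlternatingMap.ext fun x => ?_
  rw [ContinuousAlternatingMap.add_apply]
  simp only [outerMul_apply, ContinuousAlternatingMap.add_apply, smul_add, Finset.sum_add_distrib]

/-- Polarization of `v ∧ v ∧ η = 0`. -/
theorem outerMul_comm {n k : ℕ} (v w : E n →L[ℝ] ℂ) (η : F n k) :
    outerMul v (outerMul w η) = -outerMul w (outerMul v η) := by
  have h := outerMul_outerMul_self (v + w) η
  rw [outerMul_add_left v w η, outerMul_add_right, outerMul_add_left, outerMul_add_left,
    outerMul_outerMul_self, outerMul_outerMul_self, zero_add, add_zero] at h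
  exact eq_neg_of_add_eq_zero_right h

/-! ### Decomposable forms -/

theorem act_wedge {n : ℕ} (g : Spin n) : ∀ (k : ℕ) (v : Fin k → (E n →L[ℝ] ℂ)) (s : S n),
    act g (wedge k v s) = wedge k (fun a => v a ∘L spinAd g⁻¹) (spinorRep n g s)
  | 0, _, _ => rfl
  | k + 1, v, s => by rw [wedge, act_outerMul, act_wedge g k, wedge]

theorem wedge_smul {n : ℕ} : ∀ (k : ℕ) (c : Fin k → ℂ) (d : ℂ) (v : Fin k → (E n →L[ℝ] ℂ))
    (s : S n), wedge k (fun a => c a • v a) (d • s) = ((∏ a, c a) * d) • wedge k v s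
  | 0, c, d, v, s => by
    rw [Finset.univ_eq_empty, Finset.prod_empty, one_mul]; rfl
  | k + 1, c, d, v, s => by
    rw [wedge, wedge_smul k (fun a => c a.succ), outerMul_smul_smul, wedge, Fin.prod_univ_succ,
      mul_assoc]

/-- Outer multiplication inserts `w` in front, while the next highest weight vector has its new
covector last; moving `w` past `k` covectors costs `(-1) ^ k`. -/
theorem outerMul_wedge {n : ℕ} (w : E n →L[ℝ] ℂ) : ∀ (k : ℕ) (v : Fin (k + 1) → (E n →L[ℝ] ℂ))
    (s : S n), v (Fin.last k) = w →
      outerMul w (wedge k (fun a => v a.castSucc) s) = (-1 : ℂ) ^ k • wedge (k + 1) v s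
  | 0, v, s, h => by
    rw [pow_zero, one_smul, wedge, ← h]; rfl
  | k + 1, v, s, h => by
    rw [wedge, outerMul_comm]
    have := outerMul_wedge w k (fun a => v a.succ) s h
    simp only [Fin.succ_castSucc] at this
    rw [this, outerMul_smul_right, pow_succ, mul_neg_one]
    exact (neg_smul ((-1 : ℂ) ^ k) (wedge (k + 1 + 1) v s)).symm

theorem wedge_apply {n : ℕ} : ∀ (k : ℕ) (v : Fin k → (E n →L[ℝ] ℂ)) (s : S n) (x : Fin k → E n),
    (∀ a b, v a (x b) = if a = b then 1 else 0) → wedge k v s x = s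
  | 0, _, _, _, _ => rfl
  | k + 1, v, s, x, h => by
    rw [wedge, outerMul_apply, Finset.sum_eq_single 0]
    · rw [h, if_pos rfl, one_smul, Fin.val_zero, pow_zero, one_smul]
      exact wedge_apply k _ s _ fun a b => by
        have := h a.succ b.succ
        simpa [Fin.removeNth, Fin.succ_inj] using this
    · intro i _ hi
      rw [h, if_neg (Ne.symm hi), zero_smul, smul_zero]
    · simp

theorem nullCovector_apply {n : ℕ} (m : Fin (n / 2)) (x : E n) :
    nullCovector m x = (x (fstIdx m) : ℂ) - Complex.I * (x (sndIdx m) : ℂ) := rfl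

/-- The first basis vectors of the first `j` planes form a tuple dual to the null covectors, so the
value there is the vacuum spinor. -/
theorem hwVector_ne_zero {n j : ℕ} (hj : j ≤ n / 2) : hwVector (n := n) hj ≠ 0 := by
  intro h
  have h1 := wedge_apply j (fun a => nullCovector ⟨a.val, a.isLt.trans_le hj⟩) (vacuum n)
    (fun a => e (fstIdx ⟨a.val, a.isLt.trans_le hj⟩)) (by
      intro a b
      rw [nullCovector_apply]
      simp only [e, fstIdx, sndIdx, PiLp.single_apply, Fin.mk.injEq]
      by_cases hab : a = b
      · subst hab
        simp
      · have : a.val ≠ b.val := fun h => hab (Fin.ext h)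
        rw [if_neg (by omega), if_neg (by omega), if_neg hab]
        simp)
  change hwVector hj _ = _ at h1
  rw [h] at h1
  have h2 := congrArg (fun s : S n => s fun _ => false) h1
  simp [vacuum] at h2

theorem nullCovector_e_fst {n : ℕ} (m' m : Fin (n / 2)) :
    nullCovector m' (e (fstIdx m)) = if m' = m then 1 else 0 := by
  have h : (fstIdx m').val = (fstIdx m).val ↔ m' = m := by
    simp only [fstIdx, Fin.ext_iff]; omega
  have h' : (sndIdx m').val ≠ (fstIdx m).val := by simp only [fstIdx, sndIdx]; omega
  rw [nullCovector_apply]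
  simp only [e, PiLp.single_apply, Fin.ext_iff, h, h', if_false] at h ⊢
  split_ifs <;> simp

theorem nullCovector_e_snd {n : ℕ} (m' m : Fin (n / 2)) :
    nullCovector m' (e (sndIdx m)) = if m' = m then -Complex.I else 0 := by
  have h : (sndIdx m').val = (sndIdx m).val ↔ m' = m := by
    simp only [sndIdx, Fin.ext_iff]; omega
  have h' : (fstIdx m').val ≠ (sndIdx m).val := by simp only [fstIdx, sndIdx]; omega
  rw [nullCovector_apply]
  simp only [e, PiLp.single_apply, Fin.ext_iff, h, h', if_false] at h ⊢
  split_ifs <;> simp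

/-- Covectors transform by the inverse rotation, so the conjugate coordinate `x - i y` is the one of
weight `+1`. -/
theorem nullCovector_comp_torus {n : ℕ} (m m' : Fin (n / 2)) (θ : ℝ) :
    nullCovector m' ∘L spinAd (torus m θ)⁻¹ =
      Complex.exp ((((if m' = m then 1 else 0) * θ : ℝ) : ℂ) * Complex.I) • nullCovector m' := by
  have hx : ∀ (L L' : E n →L[ℝ] ℂ), (∀ i, L (e i) = L' (e i)) → L = L' := by
    intro L L' h
    ext x
    rw [← sum_smul_e x, map_sum, map_sum]
    simp only [map_smul, h]
  refine hx _ _ fun i => ?_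
  rw [ContinuousLinearMap.comp_apply, smul_apply, torus_inv]
  by_cases h1 : i = fstIdx m
  · subst h1
    rw [spinAd_torus_fst, map_add, map_smul, map_smul, nullCovector_e_fst, nullCovector_e_snd,
      Real.cos_neg, Real.sin_neg, Complex.exp_mul_I, ← Complex.ofReal_cos, ← Complex.ofReal_sin]
    simp only [Complex.real_smul, smul_eq_mul]
    split_ifs
    · rw [one_mul]; push_cast; ring
    · simp
  · by_cases h2 : i = sndIdx m
    · subst h2
      rw [spinAd_torus_snd, map_sub, map_smul, map_smul, nullCovector_e_fst, nullCovector_e_snd,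
        Real.cos_neg, Real.sin_neg, Complex.exp_mul_I, ← Complex.ofReal_cos, ← Complex.ofReal_sin]
      simp only [Complex.real_smul, smul_eq_mul]
      split_ifs
      · rw [one_mul]
        push_cast
        linear_combination (Complex.sin θ) * Complex.I_sq
      · simp
    · rw [spinAd_torus_of_ne m _ h1 h2]
      by_cases hm : m' = m
      · subst hm
        have : nullCovector m' (e i) = 0 := by
          rw [nullCovector_apply]
          simp [e, Ne.symm h1, Ne.symm h2]
        rw [this, smul_zero]
      · simp [hm]

theorem spinorRep_torus_vacuum {n : ℕ} (m : Fin (n / 2)) (θ : ℝ) :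
    spinorRep n (torus m θ) (vacuum n) =
      Complex.exp (((1 / 2 * θ : ℝ) : ℂ) * Complex.I) • vacuum n := by
  ext b
  rw [spinorRep_torus, PiLp.smul_apply, smul_eq_mul]
  by_cases hb : b = fun _ => false
  · subst hb
    simp
  · simp [vacuum, hb]

theorem isWeightVector_hwVector {n j : ℕ} (hj : j ≤ n / 2) :
    IsWeightVector (wt n j) (hwVector (n := n) hj) := by
  refine ⟨hwVector_ne_zero hj, fun m θ => ?_⟩
  rw [hwVector, act_wedge, spinorRep_torus_vacuum]
  simp only [nullCovector_comp_torus]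
  rw [wedge_smul, ← Complex.exp_sum, ← Complex.exp_add]
  congr 2
  rw [← Finset.sum_mul, ← add_mul]
  congr 1
  have : ∑ a : Fin j, (if (⟨a.val, a.isLt.trans_le hj⟩ : Fin (n / 2)) = m then (1 : ℝ) else 0) =
      if m.val < j then 1 else 0 := by
    split_ifs with h
    · rw [Finset.sum_eq_single ⟨m.val, h⟩]
      · simp
      · intro a _ ha
        have h'' : a.val ≠ m.val := fun h' => ha (Fin.ext h')
        exact if_neg fun h' => h'' (congrArg Fin.val h')
      · simp
    · refine Finset.sum_eq_zero fun a _ => if_neg fun h' => h ?_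
      rw [← h']
      exact a.isLt
  rw [← Complex.ofReal_sum, ← Finset.sum_mul, this, ← Complex.ofReal_add, wt]
  congr 1
  split_ifs <;> ring

/-! ### The symbol on the highest weight vector -/

theorem hwVector_mem_comp {n j : ℕ} (hj : j ≤ n / 2) : hwVector (n := n) hj ∈ comp n j j :=
  mem_comp_of_isWeightVector (fun _ _ h => h.toLex_le) (isWeightVector_hwVector hj)

theorem modelSymbol_hwVector {n j : ℕ} (hj : j + 1 ≤ n / 2) :
    modelSymbol n j (nullCovector ⟨j, hj⟩) (hwVector (n := n) ((Nat.le_succ j).trans hj)) =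
      (-1 : ℂ) ^ j • hwVector (n := n) hj := by
  have h := outerMul_wedge (nullCovector ⟨j, hj⟩) j
    (fun a : Fin (j + 1) => nullCovector (⟨a.val, a.isLt.trans_le hj⟩ : Fin (n / 2))) (vacuum n) rfl
  change outerMul _ (hwVector ((Nat.le_succ j).trans hj)) = _ • hwVector hj at h
  rw [modelSymbol, h, map_smul, proj_eq_self (hwVector_mem_comp hj)]

theorem modelSymbol_ne_zero {n j : ℕ} (hj : j + 1 ≤ n / 2) :
    modelSymbol n j (nullCovector ⟨j, hj⟩) (hwVector (n := n) ((Nat.le_succ j).trans hj)) ≠ 0 := by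
  rw [modelSymbol_hwVector]
  exact smul_ne_zero (pow_ne_zero _ (by norm_num)) (hwVector_ne_zero hj)

/-- The symbol is nontrivial for one of the real coordinate covectors. -/
theorem exists_modelSymbol_real_ne_zero {n j : ℕ} (hj : j + 1 ≤ n / 2) : ∃ i : Fin n,
    modelSymbol n j (Complex.ofRealCLM ∘L EuclideanSpace.proj i)
      (hwVector (n := n) ((Nat.le_succ j).trans hj)) ≠ 0 := by
  by_contra! h
  apply modelSymbol_ne_zero hj
  have : nullCovector (⟨j, hj⟩ : Fin (n / 2)) =
      Complex.ofRealCLM ∘L EuclideanSpace.proj (fstIdx ⟨j, hj⟩) + (-Complex.I) •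
        (Complex.ofRealCLM ∘L EuclideanSpace.proj (𝕜 := ℝ) (sndIdx (⟨j, hj⟩ : Fin (n / 2)))) := by
    ext x
    change (x (fstIdx _) : ℂ) - Complex.I * (x (sndIdx _) : ℂ) =
      (x (fstIdx _) : ℂ) + -Complex.I * (x (sndIdx _) : ℂ)
    ring
  have h1 := h (fstIdx ⟨j, hj⟩)
  have h2 := h (sndIdx ⟨j, hj⟩)
  simp only [modelSymbol] at h1 h2 ⊢
  rw [this, outerMul_add_left, outerMul_smul_left, map_add, map_smul, h1, h2, zero_add]
  exact smul_zero (A := F n (j + 1)) (-Complex.I)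

/-! ## Smooth dependence of the action on the group element -/

theorem cliff_injective (n : ℕ) : Function.Injective (cliff n) := by
  rw [injective_iff_map_eq_zero]
  intro v hv
  have h := cliff_mul_self n v
  rw [hv, zero_mul] at h
  have h1 : Q n v = 0 :=
    (map_eq_zero_iff _ (algebraMap ℝ (S n →L[ℂ] S n)).injective).1 h.symm
  rwa [Q_apply, neg_eq_zero, inner_self_eq_zero] at h1

/-- Smoothness of the transition functions is only known after `spinorRep`. A linear left inverse of
Clifford multiplication recovers the vector representation from the operators `spinorRep n g * cliff
n v * spinorRep n g⁻¹`. -/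
theorem exists_cliff_leftInverse (n : ℕ) :
    ∃ K : (S n →L[ℂ] S n) →L[ℝ] E n, ∀ v, K (cliff n v) = v := by
  obtain ⟨K, hK⟩ := (cliff n).exists_leftInverse_of_injective
    (LinearMap.ker_eq_bot.2 (cliff_injective n))
  exact ⟨LinearMap.toContinuousLinearMap K, fun v => LinearMap.congr_fun hK v⟩

theorem exists_coords_leftInverse (n k : ℕ) :
    ∃ L : ((Fin k → Fin n) → S n) →L[ℝ] F n k, ∀ η : F n k, L (fun I => η fun a => e (I a)) = η := by
  let c : F n k →ₗ[ℝ] ((Fin k → Fin n) → S n) :=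
    { toFun := fun η I => η fun a => e (I a)
      map_add' := fun _ _ => rfl
      map_smul' := fun _ _ => rfl }
  obtain ⟨L, hL⟩ := c.exists_leftInverse_of_injective (LinearMap.ker_eq_bot.2 fun η ζ h =>
    coords_injective (congrArg (WithLp.toLp 2) h))
  exact ⟨LinearMap.toContinuousLinearMap L, fun v => LinearMap.congr_fun hL v⟩

theorem cliff_spinAd {n : ℕ} (g : Spin n) (v : E n) :
    cliff n (spinAd g v) = spinorRep n g * cliff n v *
      spinorRep n ((g⁻¹ : Spin n) : CliffordAlgebra (Q n)) := by
  have h := congrArg (spinorRep n) (ι_spinAd g v)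
  rw [map_mul, map_mul] at h
  simpa only [spinorRep, CliffordAlgebra.lift_ι_apply] using h

theorem spinAd_inv_e_apply {n : ℕ} (g : Spin n) (i j : Fin n) :
    (spinAd g⁻¹ (e i)) j = (spinAd g (e j)) i := by
  rw [← inner_e_left, ← inner_e_left, ← inner_spinAd g, ← spinAd_mul, mul_inv_cancel, spinAd_one,
    real_inner_comm]

/-- The action is a smooth function of the images of `g` and `g⁻¹` in the spinor representation. -/
theorem exists_smooth_act {n k : ℕ} (η : F n k) :
    ∃ Ψ : (S n →L[ℂ] S n) × (S n →L[ℂ] S n) → F n k, ContDiff ℝ ∞ Ψ ∧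
      ∀ g : Spin n, act g η =
        Ψ (spinorRep n g, spinorRep n ((g⁻¹ : Spin n) : CliffordAlgebra (Q n))) := by
  obtain ⟨K, hK⟩ := exists_cliff_leftInverse n
  obtain ⟨L, hL⟩ := exists_coords_leftInverse n k
  refine ⟨fun p => L fun I => ContinuousLinearMap.restrictScalarsL ℂ (S n) (S n) ℝ ℝ p.1
    (∑ J : Fin k → Fin n, (∏ a, K (p.1 * cliff n (e (J a)) * p.2) (I a)) •
      η fun a => e (J a)), ?_, fun g => ?_⟩
  · refine L.contDiff.comp (contDiff_pi.2 fun I => ?_)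
    refine ((ContinuousLinearMap.restrictScalarsL ℂ (S n) (S n) ℝ ℝ).contDiff.comp
      contDiff_fst).clm_apply (ContDiff.sum fun J _ => ContDiff.fun_smul ?_ contDiff_const)
    refine contDiff_prod fun a _ => ?_
    exact (EuclideanSpace.proj (𝕜 := ℝ) (I a)).contDiff.comp (K.contDiff.comp
      ((contDiff_fst.mul contDiff_const).mul contDiff_snd))
  · rw [← hL (act g η)]
    congr 1
    funext I
    rw [act_apply, form_expand η]
    change spinorRep n g _ = spinorRep n g _
    congr 1
    refine Finset.sum_congr rfl fun J _ => ?_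
    congr 1
    refine Finset.prod_congr rfl fun a _ => ?_
    -- The arguments are rotated by `g⁻¹`; transposing turns the entry `(I a, J a)` into an entry of
    -- `g`, which is what `K` reads off.
    rw [spinAd_inv_e_apply, ← cliff_spinAd, hK]

theorem form_coe_smul {n k : ℕ} (c : ℝ) (η : F n k) : (c : ℂ) • η = c • η :=
  ContinuousAlternatingMap.ext fun _ => Complex.coe_smul c _

theorem form_zero_smul {n k : ℕ} (η : F n k) : (0 : ℝ) • η = 0 :=
  ContinuousAlternatingMap.ext fun _ => zero_smul ℝ _

theorem form_smul_zero {n k : ℕ} (c : ℂ) : c • (0 : F n k) = 0 :=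
  ContinuousAlternatingMap.ext fun _ => smul_zero c

/-! ## Differentials of functions and forms -/

theorem mvfderiv_complex_smul {n k : ℕ} {M : Type*} [TopologicalSpace M]
    [ChartedSpace (E n) M] {f : M → ℂ} {s : M → F n k} {x : M}
    (hf : MDifferentiableAt (𝓡 n) 𝓘(ℝ, ℂ) f x) (hs : MDifferentiableAt (𝓡 n) 𝓘(ℝ, F n k) s x)
    (v : TangentSpace (𝓡 n) x) :
    mvfderiv (𝓡 n) (fun y => f y • s y) x v =
      f x • mvfderiv (𝓡 n) s x v + mvfderiv (𝓡 n) f x v • s x := by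
  have h1 : HasMFDerivAt (𝓡 n) 𝓘(ℝ, ℂ × F n k) (fun y => (f y, s y)) x
      ((mvfderiv (𝓡 n) f x).prod (mvfderiv (𝓡 n) s x)) := by
    rw [modelWithCornersSelf_prod, ← chartedSpaceSelf_prod]
    exact hf.hasMFDerivAt.prodMk hs.hasMFDerivAt
  have h2 : HasFDerivAt (fun p : ℂ × F n k => p.1 • p.2) _ (f x, s x) :=
    (hasFDerivAt_fst (𝕜 := ℝ)).fun_smul hasFDerivAt_snd
  have h3 := (h2.hasMFDerivAt.comp x h1).mfderiv
  exact congrArg (fun L => L v) h3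

/-- Every real covector is the differential of a smooth function. -/
theorem exists_smooth_mvfderiv_eq {n : ℕ} {M : Type*} [TopologicalSpace M] [T2Space M]
    [ChartedSpace (E n) M] [IsManifold (𝓡 n) ∞ M] (x : M) (ξ : TangentSpace (𝓡 n) x →L[ℝ] ℝ) :
    ∃ f : M → ℝ, ContMDiff (𝓡 n) 𝓘(ℝ, ℝ) ∞ f ∧
      mvfderiv (𝓡 n) (fun y => (f y : ℂ)) x = Complex.ofRealCLM ∘L ξ := by
  obtain ⟨χ⟩ : Nonempty (SmoothBumpFunction (𝓡 n) x) := inferInstance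
  obtain ⟨D, hD⟩ := isInvertible_mfderiv_extChartAt (I := 𝓡 n) (mem_extChartAt_source (I := 𝓡 n) x)
  -- `ξ'` is `ξ` carried to the chart by the inverse `D.symm` of the chart differential. The bump
  -- function is `1` near `x`, so it does not affect the differential there.
  let ξ' : E n →L[ℝ] ℝ := ξ ∘L (D.symm : TangentSpace 𝓘(ℝ, E n) (extChartAt (𝓡 n) x x) →L[ℝ]
    TangentSpace (𝓡 n) x)
  refine ⟨fun y => χ y • ξ' (extChartAt (𝓡 n) x y), ?_, ?_⟩
  · exact χ.contMDiff_smul (ξ'.contMDiff.comp_contMDiffOn contMDiffOn_extChartAt)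
  · have h1 : (fun y => ((χ y • ξ' (extChartAt (𝓡 n) x y) : ℝ) : ℂ)) =ᶠ[nhds x]
        fun y => (Complex.ofRealCLM ∘L ξ') (extChartAt (𝓡 n) x y) := by
      filter_upwards [χ.eventuallyEq_one] with y hy
      rw [hy, Pi.one_apply, one_smul]
      rfl
    have h2 := (mdifferentiableAt_extChartAt (I := 𝓡 n) (mem_chart_source (E n) x)).hasMFDerivAt
    have h3 := ((Complex.ofRealCLM ∘L ξ').hasMFDerivAt.comp x h2).congr_of_eventuallyEq h1
    have h4 := h3.mfderiv
    refine ContinuousLinearMap.ext fun v => ?_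
    have h5 := congrArg (fun L => L v) h4
    refine h5.trans ?_
    have h6 : D.symm (mfderiv (𝓡 n) 𝓘(ℝ, E n) (extChartAt (𝓡 n) x) x v) = v := by
      rw [← hD]
      exact D.symm_apply_apply v
    exact congrArg (fun w => ((ξ w : ℝ) : ℂ)) h6

namespace SpinStructure

variable {n : ℕ} {M : Type*} [TopologicalSpace M] [ChartedSpace (E n) M]
  [IsManifold (𝓡 n) ∞ M] [RiemannianBundle (fun x : M => TangentSpace (𝓡 n) x)] {A : Type*}

/-! ## The principal symbol -/


/-- The connection term `infAct` is complex linear and contains no derivative, so the Leibniz defect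
comes from the differential alone, and its alternation is the wedge with `df`. -/
theorem extCovDeriv_complex_smul (P : SpinStructure n M A) (α : A) {k : ℕ} {f : M → ℂ}
    {s : M → F n k} {x : M} (hf : MDifferentiableAt (𝓡 n) 𝓘(ℝ, ℂ) f x)
    (hs : MDifferentiableAt (𝓡 n) 𝓘(ℝ, F n k) s x) :
    P.extCovDeriv α (fun y => f y • s y) x = f x • P.extCovDeriv α s x +
      outerMul (P.frameCovector α x (mvfderiv (𝓡 n) f x)) (s x) := by
  have : ∀ i, P.covDeriv α (fun y => f y • s y) i x =
      f x • P.covDeriv α s i x + mvfderiv (𝓡 n) f x (P.frame α i x) • s x := by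
    intro i
    simp only [covDeriv, mvfderiv_complex_smul hf hs, infAct_smul, smul_add]
    abel
  rw [extCovDeriv, extCovDeriv, outerMul, ← ContinuousAlternatingMap.alternatizeUncurryFin_smul,
    ← ContinuousAlternatingMap.alternatizeUncurryFin_add]
  congr 1
  ext v y
  simp only [this, frameCovector]
  simp [Finset.mul_sum, Finset.sum_mul, Finset.sum_add_distrib]
  congr 1 <;> exact Finset.sum_congr rfl fun _ _ => by ring

theorem hasPrincipalSymbol_T (P : SpinStructure n M A) (j : ℕ) :
    P.HasPrincipalSymbol (P.T j) (P.symbol j) := by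
  intro f hf s t hst α x hx
  have hα : t.1 α = fun y => f y • s.1 α y := funext (hst α)
  have ht : P.T j t α x = proj n (j + 1) (j + 1) (P.extCovDeriv α (t.1 α) x) := if_pos hx
  have hs : P.T j s α x = proj n (j + 1) (j + 1) (P.extCovDeriv α (s.1 α) x) := if_pos hx
  rw [ht, hs, hα, P.extCovDeriv_complex_smul α (hf.contMDiffAt.mdifferentiableAt (by simp))
    (P.mdifferentiableAt_section s α hx), map_add, map_smul, add_sub_cancel_left]
  rfl

/-- By orthonormality, pairing with the `i`-th frame vector is the real covector whose frame
components are those of the `i`-th coordinate. -/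
theorem frameCovector_inner (P : SpinStructure n M A) {α : A} {x : M} (hx : x ∈ P.U α) (i : Fin n)
    (ξ : TangentSpace (𝓡 n) x →L[ℝ] ℝ) (hξ : ∀ v, ξ v = inner ℝ (P.frame α i x) v) :
    P.frameCovector α x (Complex.ofRealCLM ∘L ξ) = Complex.ofRealCLM ∘L EuclideanSpace.proj i := by
  ext v
  have h : ∀ l, (Complex.ofRealCLM ∘L ξ) (P.frame α l x) = if i = l then 1 else 0 := by
    intro l
    rw [ContinuousLinearMap.comp_apply, hξ, P.frame_orthonormal α x hx]
    split_ifs <;> simp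
  simp [frameCovector, h]

theorem exists_symbol_ne_zero (P : SpinStructure n M A) {j : ℕ} (hj : j + 1 ≤ n / 2) {α : A}
    {x : M} (hx : x ∈ P.U α) : ∃ ξ : TangentSpace (𝓡 n) x →L[ℝ] ℝ,
      P.symbol j α x (Complex.ofRealCLM ∘L ξ)
        (hwVector (n := n) ((Nat.le_succ j).trans hj)) ≠ 0 := by
  obtain ⟨i, hi⟩ := exists_modelSymbol_real_ne_zero (n := n) hj
  refine ⟨innerSL ℝ (P.frame α i x), ?_⟩
  rw [symbol, P.frameCovector_inner hx i (innerSL ℝ (P.frame α i x)) fun v => rfl]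
  exact hi

/-! ## Sections with prescribed value -/

theorem g_self (P : SpinStructure n M A) {α : A} {x : M} (hx : x ∈ P.U α) : P.g α α x = 1 := by
  have := P.cocycle α α α x ⟨⟨hx, hx⟩, hx⟩
  exact mul_eq_left.1 this

theorem g_inv (P : SpinStructure n M A) {α β : A} {x : M} (hα : x ∈ P.U α) (hβ : x ∈ P.U β) :
    (P.g α β x)⁻¹ = P.g β α x := by
  rw [inv_eq_iff_mul_eq_one, P.cocycle α β α x ⟨⟨hα, hβ⟩, hα⟩, P.g_self hα]

/-- `exists_smooth_act` needs both `g` and `g⁻¹` to be smooth in the spinor representation; the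
inverse of `g β α` is the transition function `g α β`, smooth by assumption. -/
theorem contMDiffOn_act_g (P : SpinStructure n M A) {k : ℕ} (η : F n k) (β α : A) :
    ContMDiffOn (𝓡 n) 𝓘(ℝ, F n k) ∞ (fun x => act (P.g β α x) η) (P.U β ∩ P.U α) := by
  obtain ⟨Ψ, hΨ, h⟩ := exists_smooth_act η
  have h1 := P.g_smooth β α
  have h2 := (P.g_smooth α β).mono (Set.inter_comm (P.U β) (P.U α)).le
  refine (hΨ.contMDiff.comp_contMDiffOn (h1.prodMk_space h2)).congr fun x hx => ?_
  rw [h, P.g_inv hx.1 hx.2]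
  rfl

open Classical in
/-- The section equal to `χ • η` in the local trivialization `α`. -/
theorem exists_section (P : SpinStructure n M A) {k : ℕ} {V : Submodule ℂ (F n k)}
    (hV : IsInvariant V) {η : F n k} (hη : η ∈ V) {α : A} {χ : M → ℝ}
    (hχ : ContMDiff (𝓡 n) 𝓘(ℝ, ℝ) ∞ χ) (hsupp : tsupport χ ⊆ P.U α) :
    ∃ s : P.sections V, ∀ x ∈ P.U α, s.1 α x = χ x • η := by
  refine ⟨⟨fun β x => if x ∈ P.U β then χ x • act (P.g β α x) η else 0,
    fun β => ?_, fun β x hx => ?_, fun β x hx => if_neg hx, fun β γ x hx => ?_⟩, fun x hx => ?_⟩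
  · have : ∀ x ∈ P.U β, ContMDiffAt (𝓡 n) 𝓘(ℝ, F n k) ∞
        (fun x => χ x • act (P.g β α x) η) x := by
      intro x hx
      by_cases hα : x ∈ P.U α
      · exact hχ.contMDiffAt.smul ((P.contMDiffOn_act_g η β α).contMDiffAt
          (((P.isOpen_U β).inter (P.isOpen_U α)).mem_nhds ⟨hx, hα⟩))
      -- Outside `U α` the function `g β α` is uncontrolled, but `χ` vanishes near such points.
      · have h0 : χ =ᶠ[nhds x] 0 := notMem_tsupport_iff_eventuallyEq.1 fun h => hα (hsupp h)
        refine (contMDiffAt_const (c := (0 : F n k))).congr_of_eventuallyEq ?_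
        filter_upwards [h0] with y hy
        rw [hy, Pi.zero_apply, form_zero_smul]
    exact fun x hx => ((this x hx).contMDiffWithinAt).congr (fun y hy => if_pos hy) (if_pos hx)
  · simp only [if_pos hx]
    rw [← form_coe_smul]
    exact V.smul_mem _ (hV _ _ hη)
  · simp only [if_pos hx.1, if_pos hx.2]
    rw [← form_coe_smul, ← form_coe_smul, act_smul, ← act_mul]
    -- The cocycle condition applies only on the triple overlap; off `U α` both sides vanish with
    -- `χ`.
    by_cases hα : x ∈ P.U α
    · rw [P.cocycle β γ α x ⟨hx, hα⟩]
    · rw [image_eq_zero_of_notMem_tsupport fun h => hα (hsupp h), form_coe_smul,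
        form_coe_smul, form_zero_smul, form_zero_smul]
  · simp only [if_pos hx, P.g_self hx, act_one]

/-! ### Properness of the kernel -/

theorem exists_smul_section (P : SpinStructure n M A) {k : ℕ} {V : Submodule ℂ (F n k)} {f : M → ℝ}
    (hf : ContMDiff (𝓡 n) 𝓘(ℝ, ℝ) ∞ f) (s : P.sections V) :
    ∃ t : P.sections V, ∀ α x, t.1 α x = (f x : ℂ) • s.1 α x := by
  obtain ⟨s, hs1, hs2, hs3, hs4⟩ := s
  refine ⟨⟨fun α x => (f x : ℂ) • s α x, fun α => ?_, fun α x hx => V.smul_mem _ (hs2 α x hx),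
    fun α x hx => ?_, fun α β x hx => ?_⟩, fun α x => rfl⟩
  · simp only [form_coe_smul]
    exact hf.contMDiffOn.smul (hs1 α)
  · simp only [hs3 α x hx, form_smul_zero]
  · simp only [hs4 α β x hx, act_smul]

theorem ker_T_ne_top [T2Space M] [Nonempty M] (P : SpinStructure n M A) {j : ℕ}
    (hj : j + 1 ≤ n / 2) : LinearMap.ker (P.T j) ≠ ⊤ := by
  intro htop
  have hT : ∀ s, P.T j s = 0 := fun s => LinearMap.mem_ker.1 (htop ▸ Submodule.mem_top)
  obtain ⟨x⟩ := ‹Nonempty M›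
  obtain ⟨α, hα⟩ := P.cover x
  obtain ⟨ξ, hξ⟩ := P.exists_symbol_ne_zero hj hα
  obtain ⟨χ, -, hχ⟩ := (SmoothBumpFunction.nhds_basis_tsupport (I := 𝓡 n) x).mem_iff.1
    ((P.isOpen_U α).mem_nhds hα)
  obtain ⟨s, hs⟩ := P.exists_section (isInvariant_comp n j j)
    (hwVector_mem_comp (n := n) ((Nat.le_succ j).trans hj)) χ.contMDiff hχ
  obtain ⟨f, hf, hdf⟩ := exists_smooth_mvfderiv_eq x ξ
  obtain ⟨t, ht⟩ := P.exists_smul_section hf s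
  have h := P.hasPrincipalSymbol_T j (fun y => (f y : ℂ))
    (Complex.ofRealCLM.contMDiff.comp hf) s t ht α x hα
  -- Since `χ` is `1` at its centre `x`, the section takes the value `hwVector` there, and the
  -- symbol formula would read `0 = σ(ξ) hwVector`.
  rw [hT, hT, hdf, hs x hα, χ.eq_one, one_smul] at h
  apply hξ
  rw [← h]
  change (0 : F n (j + 1)) - (f x : ℂ) • (0 : F n (j + 1)) = 0
  rw [form_smul_zero, sub_zero]

end SpinStructure

end SpinForms

end

/-! ### The main theorem -/

theorem theorem4 {n : ℕ} (hn : 3 ≤ n)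
    {M : Type*} [TopologicalSpace M] [T2Space M] [Nonempty M]
    [ChartedSpace (EuclideanSpace ℝ (Fin n)) M] [IsManifold (𝓡 n) ∞ M]
    [RiemannianBundle (fun x : M => TangentSpace (𝓡 n) x)]
    [IsContMDiffRiemannianBundle (𝓡 n) ∞ (EuclideanSpace ℝ (Fin n))
      (fun x : M => TangentSpace (𝓡 n) x)]
    {A : Type*} (P : SpinForms.SpinStructure n M A)
    (j : ℕ) (hj : j + 1 ≤ n / 2) :
    -- the principal symbol of `T_j` is `σ(ξ) = π_{j+1,j+1} ∘ ε(ξ)`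
    P.HasPrincipalSymbol (P.T j) (P.symbol j) ∧
    -- it is nontrivial on `E^{j,j}` at every point, already for real covectors
    (∀ α, ∀ x ∈ P.U α, ∃ ξ : TangentSpace (𝓡 n) x →L[ℝ] ℝ, ∃ η ∈ SpinForms.comp n j j,
      P.symbol j α x (Complex.ofRealCLM ∘L ξ) η ≠ 0) ∧
    -- `v_1 ∧ … ∧ v_j ⊗ s_0` is a highest weight vector of `E^{j,j}`
    (SpinForms.hwVector (n := n) (j := j) (by omega) ∈ SpinForms.comp n j j ∧
      SpinForms.IsWeightVector (SpinForms.wt n j)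
        (SpinForms.hwVector (n := n) (j := j) (by omega)) ∧
      SpinForms.HasHighestWeight (SpinForms.comp n j j) (SpinForms.wt n j)) ∧
    -- `σ(v_{j+1})` maps it to `(-1)^j v_1 ∧ … ∧ v_{j+1} ⊗ s_0`, which is nonzero
    (SpinForms.modelSymbol n j (SpinForms.nullCovector ⟨j, hj⟩)
        (SpinForms.hwVector (n := n) (j := j) (by omega)) =
          (-1 : ℂ) ^ j • SpinForms.hwVector (n := n) (j := j + 1) hj ∧
      SpinForms.hwVector (n := n) (j := j + 1) hj ≠ 0) ∧
    -- the kernel of `T_j` is a proper subspace of the space of sections of `E^{j,j}`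
    LinearMap.ker (P.T j) ≠ ⊤ := by
  have hj' : j ≤ n / 2 := (Nat.le_succ j).trans hj
  refine ⟨P.hasPrincipalSymbol_T j, fun α x hx => ?_, ⟨SpinForms.hwVector_mem_comp hj',
    SpinForms.isWeightVector_hwVector hj', ⟨_, SpinForms.hwVector_mem_comp hj',
      SpinForms.isWeightVector_hwVector hj'⟩, fun ν ⟨η, _, hη⟩ => hη.toLex_le⟩,
    ⟨SpinForms.modelSymbol_hwVector hj, SpinForms.hwVector_ne_zero hj⟩, P.ker_T_ne_top hj⟩
  obtain ⟨ξ, hξ⟩ := P.exists_symbol_ne_zero hj hx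
  exact ⟨ξ, _, SpinForms.hwVector_mem_comp hj', hξ⟩
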